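/- \textbf{Setting.} Let $\xi=\{\xi(t):t\in\mathbb R\}$ be a real L\'evy process indexed by the whole line on a probability space $(\Omega,\mathscr F,\mathbf P)$: $\xi(0)=0$ a.s., a.s. c\`adl\`ag paths, independent and stationary increments. For $i=1,2$ and $j\neq i$ let $b=(b_{ij})\in\mathbb R^{2\times 2}$, $c_i\ge 0$, and let $m_i$ be a $\sigma$-finite measure on $\mathbb R_+^2\setminus\{\mathbf 0\}$ with $$\int (z_i\wedge z_i^2+z_j)\,m_i(dz)<\infty,\qquad b_{ij}+\int z_j\,m_i(dz)\le 0 .$$ Define, for $\lambda\in\mathbb R_+^2$ and $x\ge 0$, $$\phi_i(\lambda)=b_{i1}\lambda_1+b_{i2}\lambda_2+c_i\lambda_i^2+\int\big(e^{-\langle\lambda,z\rangle}-1+\langle\lambda,z\rangle\big)m_i(dz),$$ $$\phi_i^*(x)=(b_{i1}+b_{i2})x+c_ix^2+\int\big(e^{-xz_i}-1+xz_i\big)m_i(dz),$$ and let $\phi=(\phi_1,\phi_2)$. Let $I\subset\mathbb R$ be an interval. For $t\in I$ and $\lambda\in\mathbb R_+^2$ let $r\mapsto u_{r,t}(\xi,\lambda)\in\mathbb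 R_+^2$ be the unique nonnegative solution of $$u^{(i)}_{r,t}(\xi,\lambda)=\lambda_i-\int_r^t e^{\xi(s)}\phi_i\big(e^{-\xi(s)}u_{s,t}(\xi,\lambda)\big)ds,\qquad i=1,2,\quad r\in I\cap(-\infty,t],$$ and put $v_{r,t}(\xi,\lambda)=e^{-\xi(r)}u_{r,t}(\xi,e^{\xi(t)}\lambda)$. \textbf{Condition.} There is a single-type branching mechanism $$\varphi(x)=\beta_0x+\gamma x^2+\int_{(0,\infty)}(e^{-xz}-1+xz)\,m(dz),$$ with $\beta_0\in\mathbb R$, $\gamma\ge0$ and $m$ $\sigma$-finite with $\int (z\wedge z^2)\,m(dz)<\infty$, such that $\phi_1^*(x)\ge\varphi(x)$ and $\phi_2^*(x)\ge\varphi(x)$ for all $x\ge0$, and such that $\int^\infty\varphi(z)^{-1}dz<\infty$, i.e. for some $\theta>0$ the function $\varphi$ is strictly positive on $[\theta,\infty)$ and $\int_\theta^\infty\varphi(z)^{-1}dz<\infty$. Let $w_{r,t}(\xi,\cdot)$ be the random cumulant semigroup of $\varphi$: for $\lambda\ge0$, $r\mapsto w_{r,t}(\xi,\lambda)\ge0$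 is the unique nonnegative solution of $$w_{r,t}(\xi,\lambda)=\lambda-\int_r^te^{\xi(s)}\varphi\big(e^{-\xi(s)}w_{s,t}(\xi,\lambda)\big)ds,\qquad r\in I\cap(-\infty,t].$$ \textbf{Theorem.} Suppose that the Condition is satisfied. Then almost surely the following holds. The solutions $u$ and $w$ above exist and are unique, and $$u^{(i)}_{r,t}(\xi,\lambda)\le w_{r,t}(\xi,\|\lambda\|)\qquad\text{for all } r\le t \text{ in } I,\ \lambda\in\mathbb R_+^2,\ i=1,2,$$ where $\|\lambda\|=\max(\lambda_1,\lambda_2)$. If moreover $[0,\infty)\subset I$, then for every $t>0$ the limit $\bar v^{\xi}_{0,t}:=\lim_{\lambda_1,\lambda_2\to\infty}v_{0,t}(\xi,\lambda)$ exists in $\mathbb R_+^2$; and, if $\phi^*=(\phi^*_1,\phi_2^*)$ maps $\mathbb R_+$ into $\mathbb R_+^2$ and $\liminf_{t\to\infty}\xi(t)=-\infty$, then $\lim_{t\to\infty}\|\bar v^{\xi}_{0,t}\|=0$. -/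

import Mathlib

open MeasureTheory ProbabilityTheory Filter Topology Set

noncomputable section

/-- Parameters `(b, c, m)` of a two-type branching mechanism. The types `1, 2` are the elements
`0, 1` of `Fin 2`, and `m i` is a measure on the plane carried by the nonnegative quadrant
without the origin. -/
structure TwoTypeBranching where
  b : Matrix (Fin 2) (Fin 2) ℝ
  c : Fin 2 → ℝ
  m : Fin 2 → Measure (Fin 2 → ℝ)
  c_nonneg : ∀ i, 0 ≤ c i
  sigmaFinite : ∀ i, SigmaFinite (m i)
  support : ∀ i, ∀ᵐ z ∂(m i), 0 ≤ z ∧ z ≠ 0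
  integrable : ∀ i j, i ≠ j → Integrable (fun z => min (z i) (z i ^ 2) + z j) (m i)
  offDiag : ∀ i j, i ≠ j → b i j + ∫ z, z j ∂(m i) ≤ 0

namespace TwoTypeBranching

/-- The branching mechanism
`φ_i(l) = b_{i1} l_1 + b_{i2} l_2 + c_i l_i ^ 2 + ∫ (exp(-⟨l, z⟩) - 1 + ⟨l, z⟩) m_i(dz)`. -/
def mech (Φ : TwoTypeBranching) (l : Fin 2 → ℝ) : Fin 2 → ℝ := fun i =>
  ∑ j, Φ.b i j * l j + Φ.c i * l i ^ 2
    + ∫ z, (Real.exp (-(∑ j, l j * z j)) - 1 + ∑ j, l j * z j) ∂(Φ.m i)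

/-- The local projection
`φ*_i(x) = (b_{i1} + b_{i2}) x + c_i x ^ 2 + ∫ (exp(-x z_i) - 1 + x z_i) m_i(dz)`. -/
def localProj (Φ : TwoTypeBranching) (i : Fin 2) (x : ℝ) : ℝ :=
  (∑ j, Φ.b i j) * x + Φ.c i * x ^ 2
    + ∫ z, (Real.exp (-(x * z i)) - 1 + x * z i) ∂(Φ.m i)

end TwoTypeBranching

/-- Parameters `(b, c, m)` of a single-type branching mechanism, `m` being carried by `(0, ∞)`. -/
structure SingleTypeBranching where
  b : ℝ
  c : ℝ
  m : Measure ℝ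
  c_nonneg : 0 ≤ c
  sigmaFinite : SigmaFinite m
  support : ∀ᵐ z ∂m, 0 < z
  integrable : Integrable (fun z => min z (z ^ 2)) m

/-- The single-type branching mechanism
`b x + c x ^ 2 + ∫ (exp(-x z) - 1 + x z) m(dz)`. -/
def SingleTypeBranching.mech (ψ : SingleTypeBranching) (x : ℝ) : ℝ :=
  ψ.b * x + ψ.c * x ^ 2 + ∫ z, (Real.exp (-(x * z)) - 1 + x * z) ∂ψ.m

/-- Grey's condition `∫^∞ dz / f(z) < ∞`: near infinity `f` is positive and `1 / f` is
integrable. -/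
def GreyCondition (f : ℝ → ℝ) : Prop :=
  ∃ θ : ℝ, 0 < θ ∧ (∀ z, θ ≤ z → 0 < f z) ∧ IntegrableOn (fun z => (f z)⁻¹) (Ioi θ)

/-- Both components of the local projection of `Φ` dominate the single-type mechanism of `ψ`,
which satisfies Grey's condition. -/
structure DominatesGrey (Φ : TwoTypeBranching) (ψ : SingleTypeBranching) : Prop where
  le : ∀ i, ∀ z, 0 ≤ z → ψ.mech z ≤ Φ.localProj i z
  grey : GreyCondition ψ.mech

/-- Right-continuous with left limits. -/
def IsCadlagPath (ζ : ℝ → ℝ) : Prop :=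
  ∀ t, ContinuousWithinAt ζ (Ici t) t ∧ ∃ a, Tendsto ζ (𝓝[<] t) (𝓝 a)

/-- A real Lévy process indexed by the whole real line. -/
structure IsLevyProcess {Ω : Type*} [MeasurableSpace Ω] (ξ : ℝ → Ω → ℝ) (P : Measure Ω) :
    Prop where
  measurable : ∀ t, Measurable (ξ t)
  zero : ∀ᵐ ω ∂P, ξ 0 ω = 0
  cadlag : ∀ᵐ ω ∂P, IsCadlagPath (fun t => ξ t ω)
  indep : HasIndepIncrements ξ P
  stationary : ∀ s t h : ℝ, s ≤ t →
    IdentDistrib (fun ω => ξ (t + h) ω - ξ (s + h) ω) (fun ω => ξ t ω - ξ s ω) P P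

section Cumulant

variable {E : Type*} [NormedAddCommGroup E] [NormedSpace ℝ E] [PartialOrder E]

/-- `f` is a nonnegative solution on `I ∩ (-∞, t]` of
`f(r) = l - ∫_r^t exp(ζ(s)) φ(exp(-ζ(s)) f(s)) ds`.
It is used with `E = ℝ` and with `E = Fin 2 → ℝ`, where order and integral are componentwise. -/
structure IsCumulantSolution (φ : E → E) (ζ : ℝ → ℝ) (I : Set ℝ) (t : ℝ) (l : E)
    (f : ℝ → E) : Prop where
  nonneg : ∀ r ∈ I ∩ Iic t, 0 ≤ f r
  integrable : ∀ r ∈ I ∩ Iic t,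
    IntervalIntegrable (fun s => Real.exp (ζ s) • φ (Real.exp (-ζ s) • f s)) volume r t
  eq : ∀ r ∈ I ∩ Iic t,
    f r = l - ∫ s in r..t, Real.exp (ζ s) • φ (Real.exp (-ζ s) • f s)

open Classical in
/-- The random cumulant semigroup `r ↦ u_{r,t}(ζ, l)`: the solution of the equation above
(and `0` if there is none). -/
def cumulantU (φ : E → E) (ζ : ℝ → ℝ) (I : Set ℝ) (r t : ℝ) (l : E) : E :=
  if h : ∃ f, IsCumulantSolution φ ζ I t l f then h.choose r else 0

/-- `v_{r,t}(ζ, l) = exp(-ζ(r)) u_{r,t}(ζ, exp(ζ(t)) l)`. -/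
def cumulantV (φ : E → E) (ζ : ℝ → ℝ) (I : Set ℝ) (r t : ℝ) (l : E) : E :=
  Real.exp (-ζ r) • cumulantU φ ζ I r t (Real.exp (ζ t) • l)

/-- For every terminal time `t ∈ I` and every `l ≥ 0` the equation has the solution
`r ↦ u_{r,t}(ζ, l)`, and no other one on `I ∩ (-∞, t]`. -/
def CumulantWellPosed (φ : E → E) (ζ : ℝ → ℝ) (I : Set ℝ) : Prop :=
  ∀ t ∈ I, ∀ l : E, 0 ≤ l →
    IsCumulantSolution φ ζ I t l (fun r => cumulantU φ ζ I r t l) ∧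
    ∀ f, IsCumulantSolution φ ζ I t l f →
      ∀ r ∈ I ∩ Iic t, f r = cumulantU φ ζ I r t l

end Cumulant

end

/-! Almost every path is càdlàg, hence measurable and bounded on compact intervals. With the path
fixed the argument is deterministic; probability returns only for the limit `t → ∞`.

For a fixed path the equation is a backward system, and it is cooperative: `offDiag` makes `φ_i`
nonincreasing in the other coordinate. Sub- and supersolutions are therefore ordered
(`IsCumulantSolution.le`), which gives uniqueness, monotonicity in `λ` and, together with Picard
iteration for a truncated field, existence. On the diagonal `φ_i(x, x) ≥ φ*_i(x) ≥ ψ(x)`, so `(w,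
w)` is a supersolution and `u ≤ w`.

Grey's condition brings `w` down from infinity. Since `ψ` is convex with `ψ(0) = 0`, `ψ(kx) ≤ kψ(x)`
for `0 ≤ k ≤ 1`, so an environment bounded above by `B` may be replaced by the constant `B`. After a
time `δ` this bounds `w` by `e^B Y`, where `Y` depends on `δ` only
(`SingleTypeBranching.exists_solution_bound`). Monotonicity and this bound give the limit `v̄`.

If `φ* ≥ 0`, constants are supersolutions, so the norm of `u` at time `0` is at most its norm at a
later time `s`. Decay then follows once the path stays below `-N` on some interval of length `δ`,
with `δ` independent of `N`. This is `IsLevyProcess.ae_exists_low_interval`: after the first passage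
below `-N - 1`, a rise by `1` within time `δ` is no likelier than at the start, whatever `N`, and
that probability vanishes with `δ`. First passages are taken on dyadic grids, where the Markov
property needed is independence of the steps of a random walk. -/

/-! ### Backward integral inequalities -/

theorem intervalIntegral_const_mul_exp (K t x y : ℝ) :
    ∫ s in x..y, K * Real.exp (K * (t - s)) = Real.exp (K * (t - x)) - Real.exp (K * (t - y)) := by
  have h : ∀ s ∈ uIcc x y, HasDerivAt (fun s => -Real.exp (K * (t - s)))
      (K * Real.exp (K * (t - s))) s := by
    intro s _
    have h1 : HasDerivAt (fun s => K * (t - s)) (K * (0 - 1)) s :=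
      ((hasDerivAt_const s t).sub (hasDerivAt_id s)).const_mul K
    exact h1.exp.neg.congr_deriv (by ring)
  rw [intervalIntegral.integral_eq_sub_of_hasDerivAt h
    (Continuous.intervalIntegrable (by fun_prop) _ _)]
  ring

theorem continuousOn_of_eq_add_integral {E : Type*} [NormedAddCommGroup E] [NormedSpace ℝ E]
    {a t : ℝ} {d q : ℝ → E} {c : E} (hq : IntervalIntegrable q volume a t)
    (hd : ∀ r ∈ Icc a t, d r = c + ∫ s in r..t, q s) : ContinuousOn d (Icc a t) := by
  rcases lt_or_ge t a with h | hat
  · simp [Icc_eq_empty (not_le.2 h)]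
  have h1 : ContinuousOn (fun r => c + ∫ s in r..t, q s) (Icc a t) := by
    have := intervalIntegral.continuousOn_primitive_interval_left (μ := volume) (f := q)
      (a := a) (b := t) (by
        rw [uIcc_of_le hat, integrableOn_Icc_iff_integrableOn_Ioc]
        exact (intervalIntegrable_iff_integrableOn_Ioc_of_le hat).1 hq)
    rw [uIcc_of_le hat] at this
    exact continuousOn_const.add this
  exact h1.congr hd

/-- Comparison principle for systems of integral inequalities run backwards in time. -/
theorem nonpos_of_quasimonotone {ι : Type*} [Fintype ι] {a t L : ℝ} {d q : ι → ℝ → ℝ}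
    (hq : ∀ i, IntervalIntegrable (q i) volume a t)
    (hd : ∀ i, ∀ r ∈ Icc a t, d i r = d i t + ∫ s in r..t, q i s)
    (hdt : ∀ i, d i t ≤ 0) (hL : 0 ≤ L)
    (hqL : ∀ i, ∀ s ∈ Icc a t, 0 < d i s → q i s ≤ L * ∑ j, max (d j s) 0) (i : ι) (r : ℝ)
    (hr : r ∈ Icc a t) : d i r ≤ 0 := by
  have hcont : ∀ i, ContinuousOn (d i) (Icc a t) := fun i =>
    continuousOn_of_eq_add_integral (hq i) (hd i)
  -- While every component is below the barrier `ε k`, the right-hand side is at most `L · card ι ·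
  -- ε k = K ε k`, which is exactly the backward growth rate of `ε k`.
  set K : ℝ := L * Fintype.card ι with hK
  have hK0 : 0 ≤ K := by positivity
  set k : ℝ → ℝ := fun r => Real.exp (K * (t - r)) with hk
  have hkc : Continuous k := by fun_prop
  have hkpos : ∀ r, 0 < k r := fun r => Real.exp_pos _
  have key : ∀ ε > 0, ∀ i, ∀ r ∈ Icc a t, d i r < ε * k r := by
    intro ε hε
    by_contra! hcon
    obtain ⟨i₀, r₀, hr₀, hir₀⟩ := hcon
    have hcl : ∀ i, IsClosed {r | r ∈ Icc a t ∧ ε * k r ≤ d i r} := fun i => by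
      have := ((hcont i).sub (f := d i) (g := fun r => ε * k r)
        (by fun_prop)).preimage_isClosed_of_isClosed isClosed_Icc (isClosed_Ici (a := 0))
      convert this using 1
      ext r
      simp [sub_nonneg]
    have hC : IsCompact (⋃ i, {r | r ∈ Icc a t ∧ ε * k r ≤ d i r}) :=
      isCompact_Icc.of_isClosed_subset (isClosed_iUnion_of_finite hcl)
        (iUnion_subset fun i r h => h.1)
    -- `σ` is the last time at which some component `i` reaches the barrier; on `(σ, t]` all
    -- components are below it.
    obtain ⟨σ, hσ, hmax⟩ := hC.exists_isGreatest ⟨r₀, mem_iUnion.2 ⟨i₀, hr₀, hir₀⟩⟩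
    obtain ⟨i, hσI, hiσ⟩ := mem_iUnion.1 hσ
    have hlt : ∀ j, ∀ s ∈ Ioc σ t, d j s < ε * k s := by
      intro j s hs
      by_contra! hc
      exact absurd (hmax (mem_iUnion.2 ⟨j, ⟨hσI.1.trans hs.1.le, hs.2⟩, hc⟩)) (not_le.2 hs.1)
    have hsub : Icc σ t ⊆ Icc a t := Icc_subset_Icc_left hσI.1
    have hcl2 : IsCompact {r | r ∈ Icc σ t ∧ d i r ≤ 0} := by
      have := ((hcont i).mono hsub).preimage_isClosed_of_isClosed isClosed_Icc
        (isClosed_Iic (a := 0))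
      exact isCompact_Icc.of_isClosed_subset this fun r h => h.1
    -- The bound on `q i` is available only where `d i` is positive, so the integration stops at the
    -- first time `τ` after `σ` with `d i τ ≤ 0`.
    obtain ⟨τ, ⟨hτ, hdτ⟩, hmin⟩ := hcl2.exists_isLeast ⟨t, ⟨hσI.2, le_rfl⟩, hdt i⟩
    have hpos : ∀ s ∈ Ico σ τ, 0 < d i s := by
      intro s hs
      by_contra! hc
      exact absurd (hmin ⟨⟨hs.1, hs.2.le.trans hτ.2⟩, hc⟩) (not_le.2 hs.2)
    have hqi : ∀ x y, x ∈ Icc a t → y ∈ Icc a t → IntervalIntegrable (q i) volume x y := by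
      intro x y hx hy
      exact (hq i).mono_set ((uIcc_subset_Icc hx hy).trans Icc_subset_uIcc)
    have haτ := hsub hτ
    have ht : t ∈ Icc a t := ⟨hσI.1.trans hσI.2, le_rfl⟩
    have e1 : d i σ = d i τ + ∫ s in σ..τ, q i s := by
      rw [hd i σ hσI, hd i τ haτ, add_assoc, add_comm (∫ s in τ..t, q i s),
        intervalIntegral.integral_add_adjacent_intervals (hqi _ _ hσI haτ) (hqi _ _ haτ ht)]
    have e2 : ∫ s in σ..τ, q i s ≤ ∫ s in σ..τ, ε * (K * k s) := by
      refine intervalIntegral.integral_mono_on_of_le_Ioo hτ.1 (hqi _ _ hσI haτ)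
        (Continuous.intervalIntegrable (by fun_prop) _ _) ?_
      intro s hs
      have hst : s ∈ Ioc σ t := ⟨hs.1, hs.2.le.trans hτ.2⟩
      refine (hqL i s (hsub ⟨hst.1.le, hst.2⟩) (hpos s ⟨hs.1.le, hs.2⟩)).trans ?_
      have : ∑ j, max (d j s) 0 ≤ ∑ _j : ι, ε * k s :=
        Finset.sum_le_sum fun j _ => max_le (hlt j s hst).le (mul_pos hε (hkpos s)).le
      refine (mul_le_mul_of_nonneg_left this hL).trans (le_of_eq ?_)
      simp [hK]
      ring
    rw [intervalIntegral.integral_const_mul, intervalIntegral_const_mul_exp] at e2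
    have := mul_pos hε (hkpos τ)
    have e3 : ε * k σ ≤ ε * k σ - ε * k τ := by
      calc ε * k σ ≤ d i σ := hiσ
        _ ≤ 0 + ε * (Real.exp (K * (t - σ)) - Real.exp (K * (t - τ))) := by
          rw [e1]; exact add_le_add hdτ e2
        _ = _ := by simp only [hk]; ring
    linarith
  refine le_of_forall_pos_lt_add fun ε hε => ?_
  have := key (ε / k r) (div_pos hε (hkpos r)) i r hr
  rwa [div_mul_cancel₀ _ (hkpos r).ne', ← zero_add ε] at this

/-! ### Cooperative fields -/

/-- The properties of a branching mechanism that make the associated backward equation a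
cooperative system with nonnegative global solutions. -/
structure IsCumulantField {ι : Type*} [Fintype ι] (φ : (ι → ℝ) → ι → ℝ) : Prop where
  zero : φ 0 = 0
  lip : ∀ M : ℝ, ∃ L, 0 ≤ L ∧ ∀ x y, 0 ≤ x → 0 ≤ y → ‖x‖ ≤ M → ‖y‖ ≤ M →
    ‖φ x - φ y‖ ≤ L * ‖x - y‖
  anti : ∀ i x y, 0 ≤ x → x ≤ y → x i = y i → φ y i ≤ φ x i
  growth : ∃ C, 0 ≤ C ∧ ∀ x, 0 ≤ x → ∀ i, -(C * ‖x‖) ≤ φ x i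

/-- Pass through `x ⊔ y`. It agrees with `y` in coordinate `i`, so cooperativity compares these two
with no error, while `x ⊔ y - x` consists of the positive parts of `y - x`, so the Lipschitz bound
costs only those. -/
theorem IsCumulantField.exists_sub_le {ι : Type*} [Fintype ι] {φ : (ι → ℝ) → ι → ℝ}
    (hφ : IsCumulantField φ) (M : ℝ) : ∃ L, 0 ≤ L ∧ ∀ x y, 0 ≤ x → 0 ≤ y → ‖x‖ ≤ M → ‖y‖ ≤ M →
      ∀ i, x i ≤ y i → φ x i - φ y i ≤ L * ∑ j, max (y j - x j) 0 := by
  obtain ⟨L, hL, h⟩ := hφ.lip M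
  refine ⟨L, hL, fun x y hx hy hxM hyM i hi => ?_⟩
  have hM : 0 ≤ M := (norm_nonneg x).trans hxM
  have hz : 0 ≤ x ⊔ y := hx.trans le_sup_left
  have hzM : ‖x ⊔ y‖ ≤ M := by
    refine (pi_norm_le_iff_of_nonneg hM).2 fun j => ?_
    rw [Real.norm_of_nonneg (hz j), Pi.sup_apply]
    exact max_le ((le_abs_self _).trans ((norm_le_pi_norm x j).trans hxM))
      ((le_abs_self _).trans ((norm_le_pi_norm y j).trans hyM))
  have h1 : φ (x ⊔ y) i ≤ φ y i := hφ.anti i y (x ⊔ y) hy le_sup_right (by simp [hi])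
  have h2 := h x (x ⊔ y) hx hz hxM hzM
  have h3 := (le_abs_self _).trans ((norm_le_pi_norm (φ x - φ (x ⊔ y)) i).trans h2)
  have h4 : ‖x - x ⊔ y‖ ≤ ∑ j, max (y j - x j) 0 := by
    have hS : ∀ j, 0 ≤ max (y j - x j) 0 := fun j => le_max_right _ _
    refine (pi_norm_le_iff_of_nonneg (Finset.sum_nonneg fun j _ => hS j)).2 fun j => ?_
    refine le_trans (le_of_eq ?_)
      (Finset.single_le_sum (fun j _ => hS j) (Finset.mem_univ j))
    rw [Pi.sub_apply, Pi.sup_apply, norm_sub_rev, Real.norm_eq_abs,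
      abs_of_nonneg (sub_nonneg.2 le_sup_left)]
    rcases le_total (x j) (y j) with h | h
    · rw [sup_of_le_right h, max_eq_left (sub_nonneg.2 h)]
    · rw [sup_of_le_left h, max_eq_right (sub_nonpos.2 h), sub_self]
  have h5 := mul_le_mul_of_nonneg_left h4 hL
  simp only [Pi.sub_apply] at h3
  linarith

/-! ### Flow property, comparison and uniqueness of solutions -/

/-- Paths that are bounded on compact intervals. -/
def IsLocallyBddPath (ζ : ℝ → ℝ) : Prop := ∀ a t, ∃ B, ∀ s ∈ Icc a t, |ζ s| ≤ B

section

variable {E : Type*} [NormedAddCommGroup E] [NormedSpace ℝ E] [PartialOrder E]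
  {φ : E → E} {ζ : ℝ → ℝ} {I : Set ℝ} {t : ℝ} {l : E} {f : ℝ → E}

theorem Icc_subset_inter_Iic {r : ℝ} (hI : I.OrdConnected) (hr : r ∈ I) (ht : t ∈ I) :
    Icc r t ⊆ I ∩ Iic t := fun _ hs => ⟨hI.out hr ht hs, hs.2⟩

theorem IsCumulantSolution.apply_right (hf : IsCumulantSolution φ ζ I t l f) (ht : t ∈ I) :
    f t = l := by
  simpa using hf.eq t ⟨ht, self_mem_Iic⟩

theorem IsCumulantSolution.continuousOn (hf : IsCumulantSolution φ ζ I t l f)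
    (hI : I.OrdConnected) (ht : t ∈ I) {a : ℝ} (ha : a ∈ I) (hat : a ≤ t) :
    ContinuousOn f (Icc a t) := by
  refine continuousOn_of_eq_add_integral (c := l)
    (q := fun s => -(Real.exp (ζ s) • φ (Real.exp (-ζ s) • f s))) (hf.integrable a ⟨ha, hat⟩).neg ?_
  intro r hr
  rw [intervalIntegral.integral_neg, ← sub_eq_add_neg]
  exact hf.eq r (Icc_subset_inter_Iic hI ha ht hr)

/-- The flow property: a solution restricted to earlier times is a solution. -/
theorem IsCumulantSolution.restrict (hf : IsCumulantSolution φ ζ I t l f)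
    {u : ℝ} (hu : u ∈ I) (hut : u ≤ t) :
    IsCumulantSolution φ ζ I u (f u) f := by
  have hint : ∀ r ∈ I ∩ Iic u,
    IntervalIntegrable (fun s => Real.exp (ζ s) • φ (Real.exp (-ζ s) • f s)) volume r u := by
    intro r hr
    refine (hf.integrable r ⟨hr.1, hr.2.trans hut⟩).mono_set ?_
    rw [uIcc_of_le hr.2, uIcc_of_le (le_trans hr.2 hut)]
    exact Icc_subset_Icc_right hut
  refine ⟨fun r hr => hf.nonneg r ⟨hr.1, le_trans hr.2 hut⟩, hint, fun r hr => ?_⟩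
  rw [hf.eq r ⟨hr.1, le_trans hr.2 hut⟩, hf.eq u ⟨hu, hut⟩, sub_sub, add_comm (∫ s in u..t, _),
    intervalIntegral.integral_add_adjacent_intervals (hint r hr) (hf.integrable u ⟨hu, hut⟩)]

theorem IsCumulantSolution.mono_set (hf : IsCumulantSolution φ ζ I t l f) {J : Set ℝ}
    (hJ : J ⊆ I) : IsCumulantSolution φ ζ J t l f :=
  ⟨fun r hr => hf.nonneg r ⟨hJ hr.1, hr.2⟩, fun r hr => hf.integrable r ⟨hJ hr.1, hr.2⟩,
    fun r hr => hf.eq r ⟨hJ hr.1, hr.2⟩⟩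

end

theorem intervalIntegral_apply {ι : Type*} [Fintype ι] {f : ℝ → ι → ℝ} {a b : ℝ}
    (hf : IntervalIntegrable f volume a b) (i : ι) :
    (∫ s in a..b, f s) i = ∫ s in a..b, f s i :=
  ((ContinuousLinearMap.proj (R := ℝ) (φ := fun _ : ι => ℝ) i).intervalIntegral_comp_comm hf).symm

theorem IntervalIntegrable.apply {ι : Type*} [Fintype ι] {f : ℝ → ι → ℝ} {a b : ℝ}
    (hf : IntervalIntegrable f volume a b) (i : ι) :
    IntervalIntegrable (fun s => f s i) volume a b :=
  ⟨hf.1.eval i, hf.2.eval i⟩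

section

variable {ι : Type*} [Fintype ι] {φ χ : (ι → ℝ) → ι → ℝ} {ζ : ℝ → ℝ} {I : Set ℝ} {t : ℝ}
  {l l' : ι → ℝ} {f g : ℝ → ι → ℝ}

/-- Comparison of a solution with a supersolution. -/
theorem IsCumulantSolution.le (hφ : IsCumulantField φ) (hζ : IsLocallyBddPath ζ)
    (hI : I.OrdConnected) (ht : t ∈ I) (hf : IsCumulantSolution φ ζ I t l f)
    (hg : IsCumulantSolution χ ζ I t l' g) (hl : l ≤ l')
    (h : ∀ s ∈ I ∩ Iic t, χ (Real.exp (-ζ s) • g s) ≤ φ (Real.exp (-ζ s) • g s))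
    {r : ℝ} (hr : r ∈ I ∩ Iic t) : f r ≤ g r := by
  obtain ⟨B, hB⟩ := hζ r t
  have hsub := Icc_subset_inter_Iic hI hr.1 ht
  obtain ⟨M₁, hM₁⟩ := isCompact_Icc.exists_bound_of_continuousOn (hf.continuousOn hI ht hr.1 hr.2)
  obtain ⟨M₂, hM₂⟩ := isCompact_Icc.exists_bound_of_continuousOn (hg.continuousOn hI ht hr.1 hr.2)
  obtain ⟨L, hL, hLip⟩ := hφ.exists_sub_le (Real.exp B * max M₁ M₂)
  have hexp : ∀ s ∈ Icc r t, Real.exp (-ζ s) ≤ Real.exp B := fun s hs =>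
    Real.exp_le_exp.2 ((neg_le_abs _).trans (hB s hs))
  have hbd : ∀ (f : ℝ → ι → ℝ) (M : ℝ), (∀ s ∈ Icc r t, ‖f s‖ ≤ M) → M ≤ max M₁ M₂ →
      ∀ s ∈ Icc r t, ‖Real.exp (-ζ s) • f s‖ ≤ Real.exp B * max M₁ M₂ := by
    intro f M hM hM' s hs
    rw [norm_smul, Real.norm_of_nonneg (Real.exp_pos _).le]
    exact mul_le_mul (hexp s hs) ((hM s hs).trans hM') (norm_nonneg _) (Real.exp_pos _).le
  intro i
  have hfi := hf.integrable r hr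
  have hgi := hg.integrable r hr
  have hsubint : ∀ x ∈ Icc r t, uIcc x t ⊆ uIcc r t := fun x hx => by
    rw [uIcc_of_le hx.2, uIcc_of_le hr.2]; exact Icc_subset_Icc_left hx.1
  rw [← sub_nonpos]
  refine nonpos_of_quasimonotone (a := r) (t := t) (L := L) (d := fun i s => f s i - g s i)
    (q := fun i s => (Real.exp (ζ s) • χ (Real.exp (-ζ s) • g s)) i
      - (Real.exp (ζ s) • φ (Real.exp (-ζ s) • f s)) i)
    (fun i => (hgi.apply i).sub (hfi.apply i)) ?_ ?_ hL ?_ i r ⟨le_rfl, hr.2⟩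
  · intro i x hx
    have hfx := hfi.mono_set (hsubint x hx)
    have hgx := hgi.mono_set (hsubint x hx)
    rw [intervalIntegral.integral_sub (hgx.apply i) (hfx.apply i), ← intervalIntegral_apply hgx,
      ← intervalIntegral_apply hfx, hf.apply_right ht, hg.apply_right ht, hf.eq x (hsub hx),
      hg.eq x (hsub hx)]
    simp only [Pi.sub_apply]
    ring
  · intro i
    rw [hf.apply_right ht, hg.apply_right ht]
    exact sub_nonpos.2 (hl i)
  · intro i s hs hpos
    have hfn : 0 ≤ Real.exp (-ζ s) • f s := smul_nonneg (Real.exp_pos _).le (hf.nonneg s (hsub hs))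
    have hgn : 0 ≤ Real.exp (-ζ s) • g s := smul_nonneg (Real.exp_pos _).le (hg.nonneg s (hsub hs))
    -- The integrand `e^ζ (χ(e^{-ζ} g) - φ(e^{-ζ} f))` is first raised by replacing `χ` with `φ`,
    -- then bounded by the one-sided Lipschitz estimate. The factors `e^ζ` and `e^{-ζ}` cancel, so
    -- the constant is `L` itself.
    have h1 := hLip _ _ hgn hfn (hbd g M₂ hM₂ (le_max_right _ _) s hs)
      (hbd f M₁ hM₁ (le_max_left _ _) s hs) i (by
        simp only [Pi.smul_apply, smul_eq_mul]
        exact mul_le_mul_of_nonneg_left (sub_pos.1 hpos).le (Real.exp_pos _).le)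
    have h2 := h s (hsub hs) i
    have h3 : ∀ j, max ((Real.exp (-ζ s) • f s) j - (Real.exp (-ζ s) • g s) j) 0
        = Real.exp (-ζ s) * max (f s j - g s j) 0 := by
      intro j
      rw [mul_max_of_nonneg _ _ (Real.exp_pos _).le, mul_zero]
      simp [mul_sub]
    simp only [h3, ← Finset.mul_sum] at h1
    change Real.exp (ζ s) * _ - Real.exp (ζ s) * _ ≤ _
    rw [← mul_sub]
    have h4 : Real.exp (ζ s) * Real.exp (-ζ s) = 1 := by rw [← Real.exp_add]; simp
    calc _ ≤ Real.exp (ζ s) * (L * (Real.exp (-ζ s) * ∑ j, max (f s j - g s j) 0)) :=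
          mul_le_mul_of_nonneg_left (by linarith) (Real.exp_pos _).le
      _ = (Real.exp (ζ s) * Real.exp (-ζ s)) * (L * ∑ j, max (f s j - g s j) 0) := by ring
      _ = _ := by rw [h4, one_mul]

theorem IsCumulantSolution.mono (hφ : IsCumulantField φ) (hζ : IsLocallyBddPath ζ)
    (hI : I.OrdConnected) (ht : t ∈ I) (hf : IsCumulantSolution φ ζ I t l f)
    (hg : IsCumulantSolution φ ζ I t l' g) (hl : l ≤ l') {r : ℝ} (hr : r ∈ I ∩ Iic t) :
    f r ≤ g r :=
  hf.le hφ hζ hI ht hg hl (fun _ _ => le_rfl) hr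

theorem IsCumulantSolution.unique (hφ : IsCumulantField φ) (hζ : IsLocallyBddPath ζ)
    (hI : I.OrdConnected) (ht : t ∈ I) (hf : IsCumulantSolution φ ζ I t l f)
    (hg : IsCumulantSolution φ ζ I t l g) {r : ℝ} (hr : r ∈ I ∩ Iic t) : f r = g r :=
  le_antisymm (hf.mono hφ hζ hI ht hg le_rfl hr) (hg.mono hφ hζ hI ht hf le_rfl hr)

end

/-! ### Existence of solutions -/

/-- Picard's theorem for fields that are only measurable in time, with a terminal condition. -/
theorem exists_eq_sub_integral_of_lipschitz {E : Type*} [NormedAddCommGroup E] [NormedSpace ℝ E]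
    [CompleteSpace E] {a t A K : ℝ} (hat : a ≤ t) {G : ℝ → E → E} (hK : 0 ≤ K)
    (hmeas : ∀ f : ℝ → E, Continuous f → AEStronglyMeasurable (fun s => G s (f s)) volume)
    (hbdd : ∀ s ∈ Icc a t, ∀ x, ‖G s x‖ ≤ A)
    (hlip : ∀ s ∈ Icc a t, ∀ x y, ‖G s x - G s y‖ ≤ K * ‖x - y‖) (l : E) :
    ∃ f : ℝ → E, Continuous f ∧ ∀ r ∈ Icc a t, f r = l - ∫ s in r..t, G s (f s) := by
  -- The unknown is the solution divided by the weight `e^{κ(t-s)}`. With `κ ≥ 2K` the Picard map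
  -- contracts by `1/2` on the whole interval, so no subdivision is needed.
  set κ : ℝ := 2 * K + 1 with hκ
  have hκ0 : 0 < κ := by positivity
  set F : C(Icc a t, E) → ℝ → E := fun h s => Real.exp (κ * (t - s)) • IccExtend hat h s with hF
  have hFc : ∀ h, Continuous (F h) := fun h =>
    Continuous.smul (by fun_prop) (h.continuous.Icc_extend')
  have hint : ∀ h, ∀ r ∈ Icc a t, IntervalIntegrable (fun s => G s (F h s)) volume r t := by
    intro h r hr
    rw [intervalIntegrable_iff_integrableOn_Ioc_of_le hr.2]
    refine Measure.integrableOn_of_bounded (M := A) (by simp) (hmeas _ (hFc h)) ?_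
    refine (ae_restrict_iff' measurableSet_Ioc).2 (Eventually.of_forall fun s hs => ?_)
    exact hbdd s ⟨hr.1.trans hs.1.le, hs.2⟩ _
  have hTc : ∀ h, Continuous fun r : Icc a t =>
      Real.exp (-(κ * (t - r))) • (l - ∫ s in (r : ℝ)..t, G s (F h s)) := by
    intro h
    have : ContinuousOn (fun r => l - ∫ s in r..t, G s (F h s)) (Icc a t) :=
      continuousOn_of_eq_add_integral (c := l) (q := fun s => -G s (F h s))
        (hint h a ⟨le_rfl, hat⟩).neg fun r _ => by
          rw [intervalIntegral.integral_neg, ← sub_eq_add_neg]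
    exact Continuous.smul (by fun_prop) (continuousOn_iff_continuous_domRestrict.1 this)
  set T : C(Icc a t, E) → C(Icc a t, E) := fun h => ⟨_, hTc h⟩ with hT
  have hcontr : ContractingWith (1 / 2) T := by
    refine ⟨by rw [← NNReal.coe_lt_coe]; norm_num, LipschitzWith.of_dist_le_mul fun h₁ h₂ => ?_⟩
    rw [ContinuousMap.dist_le (by positivity)]
    intro r
    have hr := r.2
    set D := dist h₁ h₂ with hD
    have hD0 : 0 ≤ D := dist_nonneg
    have e1 : dist (T h₁ r) (T h₂ r) = Real.exp (-(κ * (t - r))) *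
        ‖∫ s in (r : ℝ)..t, (G s (F h₁ s) - G s (F h₂ s))‖ := by
      simp only [hT, ContinuousMap.coe_mk]
      rw [dist_eq_norm, ← smul_sub, norm_smul, Real.norm_of_nonneg (Real.exp_pos _).le,
        sub_sub_sub_cancel_left, norm_sub_rev,
        intervalIntegral.integral_sub (hint h₁ r hr) (hint h₂ r hr)]
    have e2 : ‖∫ s in (r : ℝ)..t, (G s (F h₁ s) - G s (F h₂ s))‖ ≤
        ∫ s in (r : ℝ)..t, D / 2 * (κ * Real.exp (κ * (t - s))) := by
      refine intervalIntegral.norm_integral_le_of_norm_le hr.2 (Eventually.of_forall fun s hs => ?_)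
        (Continuous.intervalIntegrable (by fun_prop) _ _)
      have hs' : s ∈ Icc a t := ⟨hr.1.trans hs.1.le, hs.2⟩
      refine (hlip s hs' _ _).trans ?_
      have : ‖F h₁ s - F h₂ s‖ ≤ Real.exp (κ * (t - s)) * D := by
        simp only [hF]
        rw [← smul_sub, norm_smul, Real.norm_of_nonneg (Real.exp_pos _).le, ← dist_eq_norm]
        exact mul_le_mul_of_nonneg_left (ContinuousMap.dist_apply_le_dist _) (Real.exp_pos _).le
      calc K * ‖F h₁ s - F h₂ s‖ ≤ κ / 2 * (Real.exp (κ * (t - s)) * D) :=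
            mul_le_mul (by rw [hκ]; linarith) this (norm_nonneg _) (by positivity)
        _ = _ := by ring
    rw [intervalIntegral.integral_const_mul, intervalIntegral_const_mul_exp, sub_self, mul_zero,
      Real.exp_zero] at e2
    rw [e1]
    have e3 : Real.exp (-(κ * (t - r))) * Real.exp (κ * (t - r)) = 1 := by
      rw [← Real.exp_add]; simp
    have e4 := Real.exp_pos (-(κ * (t - r)))
    calc _ ≤ Real.exp (-(κ * (t - r))) * (D / 2 * (Real.exp (κ * (t - r)) - 1)) :=
          mul_le_mul_of_nonneg_left e2 e4.le
      _ = D / 2 * (Real.exp (-(κ * (t - r))) * Real.exp (κ * (t - r)))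
          - Real.exp (-(κ * (t - r))) * (D / 2) := by ring
      _ ≤ _ := by
        rw [e3]
        have : 0 ≤ Real.exp (-(κ * (t - r))) * (D / 2) := by positivity
        push_cast
        linarith
  obtain ⟨h, hh⟩ : ∃ h, T h = h := ⟨_, hcontr.fixedPoint_isFixedPt⟩
  refine ⟨F h, hFc h, fun r hr => ?_⟩
  have : h ⟨r, hr⟩ = Real.exp (-(κ * (t - r))) • (l - ∫ s in r..t, G s (F h s)) :=
    (DFunLike.congr_fun hh ⟨r, hr⟩).symm
  have e : F h r = Real.exp (κ * (t - r)) • h ⟨r, hr⟩ := by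
    simp only [hF]
    rw [IccExtend_of_mem _ _ hr]
  rw [e, this, smul_smul, ← Real.exp_add]
  simp

/-- Coordinatewise projection to `[0, M]`. -/
def boxClamp {ι : Type*} (M : ℝ) (x : ι → ℝ) : ι → ℝ := fun j => max 0 (min M (x j))

theorem boxClamp_nonneg {ι : Type*} (M : ℝ) (x : ι → ℝ) : 0 ≤ boxClamp M x :=
  fun _ => le_max_left _ _

theorem boxClamp_of_mem {ι : Type*} {M : ℝ} {x : ι → ℝ} (h0 : 0 ≤ x) (hM : ∀ j, x j ≤ M) :
    boxClamp M x = x := by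
  ext j
  simpa [boxClamp, hM j] using h0 j

theorem continuous_boxClamp {ι : Type*} (M : ℝ) :
    Continuous (boxClamp M : (ι → ℝ) → ι → ℝ) := by
  unfold boxClamp
  fun_prop

section

variable {ι : Type*} [Fintype ι] {φ : (ι → ℝ) → ι → ℝ}

theorem norm_boxClamp_le {M : ℝ} (hM : 0 ≤ M) (x : ι → ℝ) : ‖boxClamp M x‖ ≤ M := by
  refine (pi_norm_le_iff_of_nonneg hM).2 fun j => ?_
  rw [Real.norm_of_nonneg (boxClamp_nonneg M x j)]
  exact max_le hM (min_le_left _ _)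

theorem norm_boxClamp_sub_le (M : ℝ) (x y : ι → ℝ) :
    ‖boxClamp M x - boxClamp M y‖ ≤ ‖x - y‖ := by
  refine (pi_norm_le_iff_of_nonneg (norm_nonneg _)).2 fun j => ?_
  refine le_trans ?_ (norm_le_pi_norm (x - y) j)
  simp only [boxClamp, Pi.sub_apply, Real.norm_eq_abs]
  refine (abs_max_sub_max_le_max _ _ _ _).trans ?_
  refine (max_le_max le_rfl (abs_min_sub_min_le_max _ _ _ _)).trans ?_
  simp

theorem IsCumulantField.continuousOn (hφ : IsCumulantField φ) : ContinuousOn φ (Ici 0) := by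
  intro x hx
  obtain ⟨L, hL, h⟩ := hφ.lip (‖x‖ + 1)
  rw [ContinuousWithinAt, tendsto_iff_norm_sub_tendsto_zero]
  have h1 : Tendsto (fun y => L * ‖y - x‖) (𝓝[Ici 0] x) (𝓝 0) := by
    have : Continuous fun y => L * ‖y - x‖ := by fun_prop
    simpa using (this.tendsto x).mono_left nhdsWithin_le_nhds
  refine squeeze_zero' (Eventually.of_forall fun _ => norm_nonneg _) ?_ h1
  have h2 : ∀ᶠ y in 𝓝[Ici 0] x, ‖y‖ < ‖x‖ + 1 :=
    nhdsWithin_le_nhds (continuous_norm.continuousAt.eventually_lt continuousAt_const (by simp))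
  filter_upwards [h2, self_mem_nhdsWithin] with y hy hy0
  exact h y x hy0 hx hy.le (by linarith)

theorem IsCumulantField.continuous_comp_posPart (hφ : IsCumulantField φ) :
    Continuous fun x => φ (x ⊔ 0) :=
  hφ.continuousOn.comp_continuous
    (continuous_pi fun j => (continuous_apply j).max continuous_const) fun _ => mem_Ici.2 le_sup_right

/-- Existence of the solution on a compact interval. -/
theorem IsCumulantField.exists_solution_Icc (hφ : IsCumulantField φ) {ζ : ℝ → ℝ}
    (hζ : IsLocallyBddPath ζ) (hζm : Measurable ζ) {a t : ℝ} (hat : a ≤ t) {l : ι → ℝ}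
    (hl : 0 ≤ l) : ∃ f, IsCumulantSolution φ ζ (Icc a t) t l f := by
  obtain ⟨B, hB⟩ := hζ a t
  obtain ⟨C, hC, hgrow⟩ := hφ.growth
  -- By the lower growth bound on `φ`, `k` dominates every component of a solution. Clamping at `M =
  -- k a` makes the field bounded and Lipschitz, and the clamp is later shown to be inactive.
  set k : ℝ → ℝ := fun r => ‖l‖ * Real.exp (C * (t - r)) with hk
  have hk0 : ∀ r, 0 ≤ k r := fun r => by positivity
  set M : ℝ := k a with hM
  have hM0 : 0 ≤ M := hk0 a
  have hkM : ∀ r ∈ Icc a t, k r ≤ M := fun r hr =>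
    mul_le_mul_of_nonneg_left (Real.exp_le_exp.2
      (mul_le_mul_of_nonneg_left (by linarith [hr.1]) hC)) (norm_nonneg _)
  obtain ⟨L, hL, hLip⟩ := hφ.lip (Real.exp B * M)
  have hexp : ∀ s ∈ Icc a t, Real.exp (-ζ s) ≤ Real.exp B := fun s hs =>
    Real.exp_le_exp.2 ((neg_le_abs _).trans (hB s hs))
  have hexp' : ∀ s ∈ Icc a t, Real.exp (ζ s) ≤ Real.exp B := fun s hs =>
    Real.exp_le_exp.2 ((le_abs_self _).trans (hB s hs))
  have hinv : ∀ s, Real.exp (ζ s) * Real.exp (-ζ s) = 1 := fun s => by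
    rw [← Real.exp_add]; simp
  set G : ℝ → (ι → ℝ) → ι → ℝ :=
    fun s x => Real.exp (ζ s) • φ (Real.exp (-ζ s) • boxClamp M x) with hG
  have harg0 : ∀ s (x : ι → ℝ), 0 ≤ Real.exp (-ζ s) • boxClamp M x := fun s x =>
    smul_nonneg (Real.exp_pos _).le (boxClamp_nonneg M x)
  have hargM : ∀ s ∈ Icc a t, ∀ x : ι → ℝ, ‖Real.exp (-ζ s) • boxClamp M x‖ ≤ Real.exp B * M := by
    intro s hs x
    rw [norm_smul, Real.norm_of_nonneg (Real.exp_pos _).le]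
    exact mul_le_mul (hexp s hs) (norm_boxClamp_le hM0 x) (norm_nonneg _) (Real.exp_pos _).le
  have hmeas : ∀ f : ℝ → ι → ℝ, Continuous f → Measurable (fun s => G s (f s)) := by
    intro f hf
    have h1 : (fun s => G s (f s)) = fun s => Real.exp (ζ s) •
        (fun x => φ (x ⊔ 0)) (Real.exp (-ζ s) • boxClamp M (f s)) := by
      ext1 s
      simp only [hG]
      rw [sup_of_le_left (harg0 s (f s))]
    rw [h1]
    have h2 : Measurable fun s => boxClamp M (f s) := ((continuous_boxClamp M).comp hf).measurable
    exact (Real.measurable_exp.comp hζm).smul (hφ.continuous_comp_posPart.measurable.comp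
      ((Real.measurable_exp.comp hζm.neg).smul h2))
  have hbdd : ∀ s ∈ Icc a t, ∀ x, ‖G s x‖ ≤ Real.exp B * (L * (Real.exp B * M)) := by
    intro s hs x
    simp only [hG]
    rw [norm_smul, Real.norm_of_nonneg (Real.exp_pos _).le]
    have := hLip _ 0 (harg0 s x) le_rfl (hargM s hs x) (by simp; positivity)
    rw [hφ.zero, sub_zero, sub_zero] at this
    exact mul_le_mul (hexp' s hs) (this.trans (mul_le_mul_of_nonneg_left (hargM s hs x) hL))
      (norm_nonneg _) (Real.exp_pos _).le
  have hGlip : ∀ s ∈ Icc a t, ∀ x y, ‖G s x - G s y‖ ≤ L * ‖x - y‖ := by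
    intro s hs x y
    simp only [hG]
    rw [← smul_sub, norm_smul, Real.norm_of_nonneg (Real.exp_pos _).le]
    have h1 := hLip _ _ (harg0 s x) (harg0 s y) (hargM s hs x) (hargM s hs y)
    rw [← smul_sub, norm_smul, Real.norm_of_nonneg (Real.exp_pos _).le] at h1
    calc _ ≤ Real.exp (ζ s) * (L * (Real.exp (-ζ s) * ‖boxClamp M x - boxClamp M y‖)) :=
          mul_le_mul_of_nonneg_left h1 (Real.exp_pos _).le
      _ = (Real.exp (ζ s) * Real.exp (-ζ s)) * (L * ‖boxClamp M x - boxClamp M y‖) := by ring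
      _ ≤ _ := by
        rw [hinv, one_mul]
        exact mul_le_mul_of_nonneg_left (norm_boxClamp_sub_le M x y) hL
  obtain ⟨f, hfc, hf⟩ := exists_eq_sub_integral_of_lipschitz hat hL
    (fun f hf => (hmeas f hf).aestronglyMeasurable) hbdd hGlip l
  have hint : ∀ r ∈ Icc a t, IntervalIntegrable (fun s => G s (f s)) volume r t := by
    intro r hr
    rw [intervalIntegrable_iff_integrableOn_Ioc_of_le hr.2]
    refine Measure.integrableOn_of_bounded (M := Real.exp B * (L * (Real.exp B * M))) (by simp)
      (hmeas _ hfc).aestronglyMeasurable ?_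
    refine (ae_restrict_iff' measurableSet_Ioc).2 (Eventually.of_forall fun s hs => ?_)
    exact hbdd s ⟨hr.1.trans hs.1.le, hs.2⟩ _
  have hft : f t = l := by simpa using hf t ⟨hat, le_rfl⟩
  have hfi : ∀ i, ∀ r ∈ Icc a t, f r i = l i - ∫ s in r..t, G s (f s) i := by
    intro i r hr
    rw [hf r hr, Pi.sub_apply, intervalIntegral_apply (hint r hr)]
  have hinti : ∀ i, IntervalIntegrable (fun s => G s (f s) i) volume a t := fun i =>
    (hint a ⟨le_rfl, hat⟩).apply i
  have hnonneg : ∀ r ∈ Icc a t, 0 ≤ f r := by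
    intro r hr i
    -- Where `f i` is negative the clamp sets coordinate `i` to `0`, and there `φ_i ≤ φ_i(0) = 0`;
    -- hence `L = 0` suffices.
    have := nonpos_of_quasimonotone (a := a) (t := t) (L := 0) (d := fun i r => -f r i)
      (q := fun i s => G s (f s) i) hinti ?_ (fun i => by simpa [hft] using hl i) le_rfl ?_ i r hr
    · exact neg_nonpos.1 this
    · intro i r hr
      rw [hfi i r hr, hft]
      ring
    · intro i s _ hpos
      rw [zero_mul]
      simp only [hG, Pi.smul_apply, smul_eq_mul]
      have h1 := hφ.anti i 0 _ le_rfl (harg0 s (f s)) (by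
        simp only [Pi.zero_apply, Pi.smul_apply, boxClamp, smul_eq_mul]
        rw [max_eq_left, mul_zero]
        exact (min_le_right _ _).trans (by linarith))
      rw [hφ.zero] at h1
      exact mul_nonpos_of_nonneg_of_nonpos (Real.exp_pos _).le h1
  have hupper : ∀ r ∈ Icc a t, ∀ i, f r i ≤ k r := by
    intro r hr i
    have hkint : ∀ r, ∫ s in r..t, C * k s = k r - ‖l‖ := by
      intro r
      have : (fun s => C * k s) = fun s => ‖l‖ * (C * Real.exp (C * (t - s))) := by
        ext s; simp only [hk]; ring
      rw [this, intervalIntegral.integral_const_mul, intervalIntegral_const_mul_exp]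
      simp only [hk]
      simp
      ring
    have hkI : ∀ x y, IntervalIntegrable (fun s => C * k s) volume x y := fun x y =>
      Continuous.intervalIntegrable (by fun_prop) _ _
    have hkt : k t = ‖l‖ := by simp [hk]
    have := nonpos_of_quasimonotone (a := a) (t := t) (L := C) (d := fun i r => f r i - k r)
      (q := fun i s => -G s (f s) i - C * k s) (fun i => (hinti i).neg.sub (hkI a t)) ?_ ?_ hC ?_
      i r hr
    · exact sub_nonpos.1 this
    · intro i x hx
      have hneg : IntervalIntegrable (fun s => -G s (f s) i) volume x t := ((hint x hx).apply i).neg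
      rw [intervalIntegral.integral_sub hneg (hkI _ _),
        intervalIntegral.integral_neg, hkint]
      rw [hfi i x hx, hkt, hft]
      ring
    · intro i
      rw [hkt, hft, sub_nonpos]
      exact (le_abs_self _).trans (norm_le_pi_norm l i)
    · intro i s hs _
      have h1 := hgrow _ (harg0 s (f s)) i
      rw [norm_smul, Real.norm_of_nonneg (Real.exp_pos _).le] at h1
      have h2 : ‖boxClamp M (f s)‖ ≤ k s + ∑ j, max (f s j - k s) 0 := by
        have hS : ∀ j, 0 ≤ max (f s j - k s) 0 := fun j => le_max_right _ _
        refine (pi_norm_le_iff_of_nonneg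
          (add_nonneg (hk0 s) (Finset.sum_nonneg fun j _ => hS j))).2 fun j => ?_
        rw [Real.norm_of_nonneg (boxClamp_nonneg M _ j)]
        have h3 := Finset.single_le_sum (f := fun j => max (f s j - k s) 0)
          (fun j _ => hS j) (Finset.mem_univ j)
        have h4 := le_max_left (f s j - k s) 0
        have h5 := hS j
        have h6 := hk0 s
        exact max_le (by linarith) ((min_le_right _ _).trans (by linarith))
      have h3 : -(C * ‖boxClamp M (f s)‖) ≤ G s (f s) i := by
        simp only [hG, Pi.smul_apply, smul_eq_mul]
        calc -(C * ‖boxClamp M (f s)‖)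
            = Real.exp (ζ s) * -(C * (Real.exp (-ζ s) * ‖boxClamp M (f s)‖)) := by
              linear_combination (C * ‖boxClamp M (f s)‖) * hinv s
          _ ≤ _ := mul_le_mul_of_nonneg_left h1 (Real.exp_pos _).le
      have h4 := mul_le_mul_of_nonneg_left h2 hC
      linarith
  have hclamp : ∀ s ∈ Icc a t, boxClamp M (f s) = f s := fun s hs =>
    boxClamp_of_mem (hnonneg s hs) fun j => (hupper s hs j).trans (hkM s hs)
  have hcongr : ∀ r ∈ Icc a t, EqOn (fun s => G s (f s))
      (fun s => Real.exp (ζ s) • φ (Real.exp (-ζ s) • f s)) (uIcc r t) := by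
    intro r hr s hs
    rw [uIcc_of_le hr.2] at hs
    simp only [hG]
    rw [hclamp s ⟨hr.1.trans hs.1, hs.2⟩]
  refine ⟨f, fun r hr => hnonneg r hr.1, fun r hr => ?_, fun r hr => ?_⟩
  · exact (hint r hr.1).congr ((hcongr r hr.1).mono uIoc_subset_uIcc)
  · rw [hf r hr.1, intervalIntegral.integral_congr (hcongr r hr.1)]

/-- By uniqueness the solutions on the intervals `[a, t]` agree on overlaps, and `r ↦ F r r` glues
them. -/
theorem IsCumulantField.exists_solution (hφ : IsCumulantField φ) {ζ : ℝ → ℝ}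
    (hζ : IsLocallyBddPath ζ) (hζm : Measurable ζ) (I : Set ℝ) (t : ℝ)
    {l : ι → ℝ} (hl : 0 ≤ l) : ∃ f, IsCumulantSolution φ ζ I t l f := by
  have hex : ∀ a : ℝ, ∃ f, a ≤ t → IsCumulantSolution φ ζ (Icc a t) t l f := by
    intro a
    by_cases hat : a ≤ t
    · obtain ⟨f, hf⟩ := hφ.exists_solution_Icc hζ hζm hat hl
      exact ⟨f, fun _ => hf⟩
    · exact ⟨0, fun h => absurd h hat⟩
  choose F hF using hex
  have hag : ∀ a ≤ t, ∀ r ∈ Icc a t, F r r = F a r := by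
    intro a ha r hr
    exact (hF r hr.2).unique hφ hζ ordConnected_Icc ⟨hr.2, le_rfl⟩
      ((hF a ha).mono_set (Icc_subset_Icc_left hr.1)) ⟨⟨le_rfl, hr.2⟩, hr.2⟩
  have hcongr : ∀ r ≤ t, EqOn (fun s => Real.exp (ζ s) • φ (Real.exp (-ζ s) • F r s))
      (fun s => Real.exp (ζ s) • φ (Real.exp (-ζ s) • F s s)) (uIcc r t) := by
    intro r hr s hs
    rw [uIcc_of_le hr] at hs
    simp only
    rw [hag r hr s hs]
  refine ⟨fun r => F r r, fun r hr => ?_, fun r hr => ?_, fun r hr => ?_⟩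
  · exact (hF r hr.2).nonneg r ⟨⟨le_rfl, hr.2⟩, hr.2⟩
  · exact ((hF r hr.2).integrable r ⟨⟨le_rfl, hr.2⟩, hr.2⟩).congr
      ((hcongr r hr.2).mono uIoc_subset_uIcc)
  · exact ((hF r hr.2).eq r ⟨⟨le_rfl, hr.2⟩, hr.2⟩).trans
      (by rw [intervalIntegral.integral_congr (hcongr r hr.2)])

end

theorem cumulantWellPosed_of_exists_unique {E : Type*} [NormedAddCommGroup E] [NormedSpace ℝ E]
    [PartialOrder E] {φ : E → E} {ζ : ℝ → ℝ} {I : Set ℝ}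
    (hex : ∀ t ∈ I, ∀ l : E, 0 ≤ l → ∃ f, IsCumulantSolution φ ζ I t l f)
    (huniq : ∀ t ∈ I, ∀ l : E, ∀ f g, IsCumulantSolution φ ζ I t l f →
      IsCumulantSolution φ ζ I t l g → ∀ r ∈ I ∩ Iic t, f r = g r) :
    CumulantWellPosed φ ζ I := by
  intro t ht l hl
  have h := hex t ht l hl
  -- The choice in `cumulantU` does not depend on `r`, so its values at different `r` belong to one
  -- and the same solution.
  have e : (fun r => cumulantU φ ζ I r t l) = h.choose := by
    ext1 r
    simp only [cumulantU, dif_pos h]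
  rw [e]
  refine ⟨h.choose_spec, fun f hf r hr => ?_⟩
  rw [huniq t ht l f _ hf h.choose_spec r hr]
  exact (congrFun e r).symm

theorem IsCumulantField.wellPosed {ι : Type*} [Fintype ι] {φ : (ι → ℝ) → ι → ℝ}
    (hφ : IsCumulantField φ) {ζ : ℝ → ℝ} (hζ : IsLocallyBddPath ζ) (hζm : Measurable ζ)
    {I : Set ℝ} (hI : I.OrdConnected) : CumulantWellPosed φ ζ I :=
  cumulantWellPosed_of_exists_unique
    (fun t _ _ hl => hφ.exists_solution hζ hζm I t hl)
    (fun _ ht _ _ _ hf hg _ hr => hf.unique hφ hζ hI ht hg hr)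

/-- A scalar solution is a solution of the diagonal system. -/
theorem IsCumulantSolution.diag {ι : Type*} [Fintype ι] {φ : ℝ → ℝ} {ζ : ℝ → ℝ} {I : Set ℝ}
    {t l : ℝ} {f : ℝ → ℝ} (hf : IsCumulantSolution φ ζ I t l f) (j₀ : ι) :
    IsCumulantSolution (fun (x : ι → ℝ) _ => φ (x j₀)) ζ I t (fun _ => l) (fun r _ => f r) := by
  have hint : ∀ r ∈ I ∩ Iic t, IntervalIntegrable
      (fun s => Real.exp (ζ s) • (fun _ : ι => φ ((Real.exp (-ζ s) • fun _ : ι => f s) j₀)))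
      volume r t := by
    intro r hr
    have := hf.integrable r hr
    exact ⟨Integrable.of_eval fun _ => this.1, Integrable.of_eval fun _ => this.2⟩
  refine ⟨fun r hr _ => hf.nonneg r hr, hint, fun r hr => ?_⟩
  ext i
  rw [Pi.sub_apply, intervalIntegral_apply (hint r hr)]
  exact hf.eq r hr

theorem IsCumulantSolution.apply {ι : Type*} [Fintype ι] {φ : ℝ → ℝ} {ζ : ℝ → ℝ} {I : Set ℝ}
    {t l : ℝ} {f : ℝ → ι → ℝ} {j₀ : ι}
    (hf : IsCumulantSolution (fun (x : ι → ℝ) _ => φ (x j₀)) ζ I t (fun _ => l) f) :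
    IsCumulantSolution φ ζ I t l (fun r => f r j₀) := by
  refine ⟨fun r hr => hf.nonneg r hr j₀, fun r hr => (hf.integrable r hr).apply j₀, fun r hr => ?_⟩
  have := congrFun (hf.eq r hr) j₀
  rw [Pi.sub_apply, intervalIntegral_apply (hf.integrable r hr)] at this
  exact this

/-- The scalar equation is treated as the system indexed by `Unit`, to which the theory of
cooperative fields applies. -/
theorem CumulantWellPosed.of_diag {φ : ℝ → ℝ} {ζ : ℝ → ℝ} {I : Set ℝ}
    (hφ : IsCumulantField (fun (x : Unit → ℝ) _ => φ (x ()))) (hζ : IsLocallyBddPath ζ)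
    (hζm : Measurable ζ) (hI : I.OrdConnected) : CumulantWellPosed φ ζ I := by
  refine cumulantWellPosed_of_exists_unique (fun t ht l hl => ?_)
    (fun t ht l f g hf hg r hr => ?_)
  · obtain ⟨f, hf⟩ := hφ.exists_solution hζ hζm I t (l := fun _ => l) (fun _ => hl)
    exact ⟨_, hf.apply⟩
  · exact congrFun ((hf.diag ()).unique hφ hζ hI ht (hg.diag ()) hr) ()

/-! ### Regularity of càdlàg paths -/

theorem IsCadlagPath.isLocallyBdd {ζ : ℝ → ℝ} (h : IsCadlagPath ζ) : IsLocallyBddPath ζ := by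
  intro a t
  refine isCompact_Icc.induction_on (p := fun s => ∃ B, ∀ x ∈ s, |ζ x| ≤ B) ⟨0, by simp⟩ ?_ ?_ ?_
  · rintro s u hsu ⟨B, hB⟩
    exact ⟨B, fun x hx => hB x (hsu hx)⟩
  · rintro s u ⟨B, hB⟩ ⟨C, hC⟩
    exact ⟨max B C, fun x hx => hx.elim (fun hx => (hB x hx).trans (le_max_left _ _))
      (fun hx => (hC x hx).trans (le_max_right _ _))⟩
  · intro x _
    obtain ⟨h1, y, h2⟩ := h x
    have e1 : ∀ᶠ s in 𝓝[≥] x, |ζ s| < |ζ x| + 1 :=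
      (h1.abs).eventually_lt continuousWithinAt_const (by simp)
    have e2 : ∀ᶠ s in 𝓝[<] x, |ζ s| < |y| + 1 := h2.abs.eventually_lt_const (by simp)
    have e3 : ∀ᶠ s in 𝓝 x, |ζ s| ≤ max (|ζ x| + 1) (|y| + 1) := by
      rw [← nhdsLT_sup_nhdsGE, eventually_sup]
      exact ⟨e2.mono fun s hs => hs.le.trans (le_max_right _ _),
        e1.mono fun s hs => hs.le.trans (le_max_left _ _)⟩
    exact ⟨_, nhdsWithin_le_nhds e3, _, fun s hs => hs⟩

theorem IsCadlagPath.measurable {ζ : ℝ → ℝ} (h : IsCadlagPath ζ) : Measurable ζ := by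
  -- The approximation points lie strictly to the right of `x`, at distance at most `1/(n+1)`, so
  -- right-continuity gives convergence. Each approximant factors through `ℤ`.
  refine measurable_of_tendsto_metrizable
    (f := fun (n : ℕ) x => ζ (((⌊(n + 1 : ℝ) * x⌋ : ℝ) + 1) / (n + 1))) ?_ ?_
  · intro n
    have h1 : Measurable fun k : ℤ => ζ (((k : ℝ) + 1) / (n + 1)) := measurable_from_top
    exact h1.comp (Int.measurable_floor.comp (measurable_const_mul _))
  · rw [tendsto_pi_nhds]
    intro x
    refine (h x).1.tendsto.comp (tendsto_nhdsWithin_iff.2 ⟨?_, Eventually.of_forall fun n => ?_⟩)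
    · have h1 : Tendsto (fun n : ℕ => x + 1 / ((n : ℝ) + 1)) atTop (𝓝 x) := by
        simpa using tendsto_one_div_add_atTop_nhds_zero_nat.const_add x
      refine tendsto_of_tendsto_of_tendsto_of_le_of_le tendsto_const_nhds h1 (fun n => ?_)
        fun n => ?_
      · have : (0 : ℝ) < n + 1 := by positivity
        simp only
        rw [le_div_iff₀ this]
        linarith [Int.lt_floor_add_one ((n + 1 : ℝ) * x)]
      · have : (0 : ℝ) < n + 1 := by positivity
        simp only
        rw [div_le_iff₀ this, add_mul x, div_mul_cancel₀ _ this.ne']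
        linarith [Int.floor_le ((n + 1 : ℝ) * x)]
    · have : (0 : ℝ) < n + 1 := by positivity
      simp only [mem_Ici]
      rw [le_div_iff₀ this]
      linarith [Int.lt_floor_add_one ((n + 1 : ℝ) * x)]

/-! ### Analysis of the branching mechanisms -/

/-- The compensated exponential `exp(-y) - 1 + y`. -/
noncomputable def expRem (y : ℝ) : ℝ := Real.exp (-y) - 1 + y

theorem expRem_zero : expRem 0 = 0 := by simp [expRem]

theorem continuous_expRem : Continuous expRem := by unfold expRem; fun_prop

theorem expRem_nonneg (y : ℝ) : 0 ≤ expRem y := by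
  have := Real.add_one_le_exp (-y)
  unfold expRem
  linarith

theorem expRem_mono {a b : ℝ} (ha : 0 ≤ a) (hab : a ≤ b) : expRem a ≤ expRem b := by
  have h1 : Real.exp (-b) = Real.exp (-a) * Real.exp (-(b - a)) := by
    rw [← Real.exp_add]; congr 1; ring
  have h2 := Real.add_one_le_exp (-(b - a))
  have h3 : Real.exp (-a) ≤ 1 := Real.exp_le_one_iff.2 (by linarith)
  have h4 := Real.exp_pos (-a)
  have h5 : Real.exp (-(b - a)) ≤ 1 := Real.exp_le_one_iff.2 (by linarith)
  unfold expRem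
  rw [h1]
  nlinarith

theorem expRem_sub_le {a b : ℝ} (hab : a ≤ b) : expRem b - expRem a ≤ b - a := by
  have : Real.exp (-b) ≤ Real.exp (-a) := Real.exp_le_exp.2 (by linarith)
  unfold expRem
  linarith

theorem expRem_sub_le_mul {a b : ℝ} (hab : a ≤ b) :
    expRem b - expRem a ≤ b * (b - a) := by
  have h1 : Real.exp (-a) = Real.exp (-b) * Real.exp (b - a) := by
    rw [← Real.exp_add]; congr 1; ring
  have h2 := Real.add_one_le_exp (b - a)
  have h3 := Real.add_one_le_exp (-b)
  have h4 := Real.exp_pos (-b)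
  have h5 : Real.exp (-b) * (b - a) ≤ Real.exp (-b) * (Real.exp (b - a) - 1) :=
    mul_le_mul_of_nonneg_left (by linarith) h4.le
  have h6 : (1 - b) * (b - a) ≤ Real.exp (-b) * (b - a) :=
    mul_le_mul_of_nonneg_right (by linarith) (by linarith)
  unfold expRem
  rw [h1]
  linarith

/-- The derivative `1 - e^{-y}` lies between `0` and `min(1, y)` for `y ≥ 0`. -/
theorem abs_expRem_sub_le {a b M : ℝ} (ha : 0 ≤ a) (hb : 0 ≤ b) (haM : a ≤ M) (hbM : b ≤ M) :
    |expRem a - expRem b| ≤ min 1 M * |a - b| := by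
  wlog hab : a ≤ b generalizing a b
  · rw [abs_sub_comm, abs_sub_comm a]
    exact this hb ha hbM haM (le_of_not_ge hab)
  rw [abs_sub_comm, abs_sub_comm a, abs_of_nonneg (sub_nonneg.2 (expRem_mono ha hab)),
    abs_of_nonneg (sub_nonneg.2 hab)]
  rcases min_choice 1 M with h | h <;> rw [h]
  · rw [one_mul]; exact expRem_sub_le hab
  · exact (expRem_sub_le_mul hab).trans
      (mul_le_mul_of_nonneg_right hbM (sub_nonneg.2 hab))

/-- Convexity together with the value `0` at `0`. -/
theorem expRem_mul_le {k y : ℝ} (hk0 : 0 ≤ k) (hk1 : k ≤ 1) : expRem (k * y) ≤ k * expRem y := by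
  have := convexOn_exp.2 (mem_univ 0) (mem_univ (-y)) (sub_nonneg.2 hk1) hk0 (by ring)
  simp only [smul_eq_mul, mul_zero, zero_add, Real.exp_zero, mul_one] at this
  unfold expRem
  rw [← mul_neg]
  linarith

/-- Converts the Lipschitz bound on `expRem` into a multiple of the function that the moment
condition makes integrable: truncated quadratic in the own coordinate `p`, linear in the other
coordinate `q`. -/
theorem min_one_mul_le {p q M : ℝ} (hp : 0 ≤ p) (hq : 0 ≤ q) (hM : 0 ≤ M) :
    min 1 (M * (p + q)) * (p + q) ≤ (2 + 2 * M) * (min p (p ^ 2) + q) := by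
  have hpq : 0 ≤ p + q := add_nonneg hp hq
  have h1 : min 1 (M * (p + q)) * (p + q) ≤ p + q :=
    (mul_le_mul_of_nonneg_right (min_le_left _ _) hpq).trans (by rw [one_mul])
  have h2 : min 1 (M * (p + q)) * (p + q) ≤ M * (p + q) * (p + q) :=
    mul_le_mul_of_nonneg_right (min_le_right _ _) hpq
  rcases le_total 1 p with h | h
  · rw [min_eq_left (a := p) (by nlinarith)]
    nlinarith [mul_nonneg hM hpq]
  · rw [min_eq_right (a := p) (by nlinarith)]
    rcases le_total q 1 with hq1 | hq1
    · refine h2.trans ?_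
      have h3 : (p + q) * (p + q) ≤ 2 * (p ^ 2 + q) := by nlinarith [sq_nonneg (p - q)]
      have h4 := mul_le_mul_of_nonneg_left h3 hM
      nlinarith [sq_nonneg p]
    · nlinarith [mul_nonneg hM (add_nonneg (sq_nonneg p) hq), sq_nonneg p]

theorem abs_expRem_pair_sub_le {p q x₁ x₂ y₁ y₂ M D : ℝ} (hp : 0 ≤ p) (hq : 0 ≤ q)
    (hx₁ : 0 ≤ x₁) (hx₂ : 0 ≤ x₂) (hy₁ : 0 ≤ y₁) (hy₂ : 0 ≤ y₂) (hx₁M : x₁ ≤ M) (hx₂M : x₂ ≤ M)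
    (hy₁M : y₁ ≤ M) (hy₂M : y₂ ≤ M) (hD₁ : |x₁ - y₁| ≤ D) (hD₂ : |x₂ - y₂| ≤ D) :
    |expRem (x₁ * p + x₂ * q) - expRem (y₁ * p + y₂ * q)|
      ≤ (2 + 2 * M) * D * (min p (p ^ 2) + q) := by
  have hM : 0 ≤ M := hx₁.trans hx₁M
  have hD : 0 ≤ D := (abs_nonneg _).trans hD₁
  have hdiff : |(x₁ * p + x₂ * q) - (y₁ * p + y₂ * q)| ≤ D * (p + q) := by
    have e : (x₁ * p + x₂ * q) - (y₁ * p + y₂ * q) = (x₁ - y₁) * p + (x₂ - y₂) * q := by ring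
    rw [e, mul_add]
    refine (abs_add_le _ _).trans (add_le_add ?_ ?_)
    · rw [abs_mul, abs_of_nonneg hp]; exact mul_le_mul_of_nonneg_right hD₁ hp
    · rw [abs_mul, abs_of_nonneg hq]; exact mul_le_mul_of_nonneg_right hD₂ hq
  have hmin : 0 ≤ min 1 (M * (p + q)) := le_min zero_le_one (by positivity)
  calc _ ≤ min 1 (M * (p + q)) * |(x₁ * p + x₂ * q) - (y₁ * p + y₂ * q)| :=
        abs_expRem_sub_le (by positivity) (by positivity)
          (by rw [mul_add]; gcongr) (by rw [mul_add]; gcongr)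
    _ ≤ min 1 (M * (p + q)) * (D * (p + q)) := mul_le_mul_of_nonneg_left hdiff hmin
    _ = D * (min 1 (M * (p + q)) * (p + q)) := by ring
    _ ≤ D * ((2 + 2 * M) * (min p (p ^ 2) + q)) :=
        mul_le_mul_of_nonneg_left (min_one_mul_le hp hq hM) hD
    _ = _ := by ring

theorem Fin.sum_two_of_ne {i j : Fin 2} (h : i ≠ j) (f : Fin 2 → ℝ) : ∑ k, f k = f i + f j := by
  rw [Fin.sum_univ_two]
  fin_cases i <;> fin_cases j <;> simp_all [add_comm]

theorem Fin.exists_ne_two (i : Fin 2) : ∃ j, i ≠ j := ⟨i + 1, by fin_cases i <;> simp⟩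

namespace TwoTypeBranching

variable (Φ : TwoTypeBranching)

theorem mech_apply {i j : Fin 2} (h : i ≠ j) (l : Fin 2 → ℝ) :
    Φ.mech l i = Φ.b i i * l i + Φ.b i j * l j + Φ.c i * l i ^ 2
      + ∫ z, expRem (l i * z i + l j * z j) ∂(Φ.m i) := by
  simp only [mech, Fin.sum_two_of_ne h, expRem]

theorem integrable_coord {i j : Fin 2} (h : i ≠ j) : Integrable (fun z => z j) (Φ.m i) := by
  refine (Φ.integrable i j h).mono' (measurable_pi_apply j).aestronglyMeasurable ?_
  filter_upwards [Φ.support i] with z hz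
  have := hz.1 i
  rw [Real.norm_of_nonneg (hz.1 j)]
  have : 0 ≤ min (z i) (z i ^ 2) := le_min this (sq_nonneg _)
  linarith

theorem integrable_expRem {i j : Fin 2} (h : i ≠ j) {x y : ℝ} (hx : 0 ≤ x) (hy : 0 ≤ y) :
    Integrable (fun z => expRem (x * z i + y * z j)) (Φ.m i) := by
  refine ((Φ.integrable i j h).const_mul ((2 + 2 * max x y) * max x y)).mono'
    (continuous_expRem.comp (by fun_prop)).aestronglyMeasurable ?_
  filter_upwards [Φ.support i] with z hz
  have hM : 0 ≤ max x y := hx.trans (le_max_left _ _)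
  have := abs_expRem_pair_sub_le (hz.1 i) (hz.1 j) hx hy le_rfl le_rfl (le_max_left x y)
    (le_max_right x y) hM hM (D := max x y) (by simp [abs_of_nonneg hx])
    (by simp [abs_of_nonneg hy])
  simpa [expRem_zero] using this

theorem mech_lip (i : Fin 2) {M : ℝ} (hM : 0 ≤ M) : ∃ L, 0 ≤ L ∧ ∀ x y, 0 ≤ x → 0 ≤ y →
    ‖x‖ ≤ M → ‖y‖ ≤ M → |Φ.mech x i - Φ.mech y i| ≤ L * ‖x - y‖ := by
  obtain ⟨j, hij⟩ := Fin.exists_ne_two i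
  set J := ∫ z, (min (z i) (z i ^ 2) + z j) ∂(Φ.m i) with hJ
  have hJ0 : 0 ≤ J := by
    refine integral_nonneg_of_ae ?_
    filter_upwards [Φ.support i] with z hz
    exact add_nonneg (le_min (hz.1 i) (sq_nonneg _)) (hz.1 j)
  refine ⟨|Φ.b i i| + |Φ.b i j| + Φ.c i * (2 * M) + (2 + 2 * M) * J, ?_, ?_⟩
  · have := Φ.c_nonneg i
    positivity
  intro x y hx hy hxM hyM
  set D := ‖x - y‖ with hD
  have hxk : ∀ k, x k ≤ M := fun k => (le_abs_self _).trans ((norm_le_pi_norm x k).trans hxM)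
  have hyk : ∀ k, y k ≤ M := fun k => (le_abs_self _).trans ((norm_le_pi_norm y k).trans hyM)
  have hDk : ∀ k, |x k - y k| ≤ D := fun k => norm_le_pi_norm (x - y) k
  have hint : |∫ z, expRem (x i * z i + x j * z j) ∂(Φ.m i)
      - ∫ z, expRem (y i * z i + y j * z j) ∂(Φ.m i)| ≤ (2 + 2 * M) * D * J := by
    rw [← integral_sub (Φ.integrable_expRem hij (hx i) (hx j))
      (Φ.integrable_expRem hij (hy i) (hy j)), hJ, ← integral_const_mul, ← Real.norm_eq_abs]
    refine norm_integral_le_of_norm_le ((Φ.integrable i j hij).const_mul _) ?_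
    filter_upwards [Φ.support i] with z hz
    exact abs_expRem_pair_sub_le (hz.1 i) (hz.1 j) (hx i) (hx j) (hy i) (hy j) (hxk i) (hxk j)
      (hyk i) (hyk j) (hDk i) (hDk j)
  rw [Φ.mech_apply hij, Φ.mech_apply hij]
  have e1 : |Φ.b i i * (x i - y i)| ≤ |Φ.b i i| * D := by
    rw [abs_mul]; exact mul_le_mul_of_nonneg_left (hDk i) (abs_nonneg _)
  have e2 : |Φ.b i j * (x j - y j)| ≤ |Φ.b i j| * D := by
    rw [abs_mul]; exact mul_le_mul_of_nonneg_left (hDk j) (abs_nonneg _)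
  have e3 : |Φ.c i * ((x i + y i) * (x i - y i))| ≤ Φ.c i * (2 * M * D) := by
    rw [abs_mul, abs_of_nonneg (Φ.c_nonneg i), abs_mul,
      abs_of_nonneg (add_nonneg (hx i) (hy i))]
    exact mul_le_mul_of_nonneg_left (mul_le_mul (by linarith [hxk i, hyk i]) (hDk i)
      (abs_nonneg _) (by positivity)) (Φ.c_nonneg i)
  rw [abs_le] at *
  constructor <;> nlinarith

theorem isCumulantField : IsCumulantField Φ.mech where
  zero := by
    ext i
    obtain ⟨j, hij⟩ := Fin.exists_ne_two i
    rw [Φ.mech_apply hij]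
    simp [expRem_zero]
  lip M := by
    rcases lt_or_ge M 0 with hM | hM
    · exact ⟨0, le_rfl, fun x y _ _ hx _ => absurd (hx.trans_lt hM) (norm_nonneg x).not_gt⟩
    choose L hL h using fun i => Φ.mech_lip i hM
    refine ⟨∑ i, L i, Finset.sum_nonneg fun i _ => hL i, fun x y hx hy hxM hyM => ?_⟩
    refine (pi_norm_le_iff_of_nonneg
      (mul_nonneg (Finset.sum_nonneg fun i _ => hL i) (norm_nonneg _))).2 fun i => ?_
    exact (h i x y hx hy hxM hyM).trans (mul_le_mul_of_nonneg_right
      (Finset.single_le_sum (fun i _ => hL i) (Finset.mem_univ i)) (norm_nonneg _))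
  anti i x y hx hxy hi := by
    obtain ⟨j, hij⟩ := Fin.exists_ne_two i
    have hy := hx.trans hxy
    rw [Φ.mech_apply hij, Φ.mech_apply hij, hi]
    -- `expRem` has slope at most `1`, so raising coordinate `j` raises the integral by at most `(y
    -- j - x j) ∫ z_j`; `offDiag` says that the linear term compensates this.
    have h1 : ∫ z, expRem (y i * z i + y j * z j) ∂(Φ.m i)
        - ∫ z, expRem (y i * z i + x j * z j) ∂(Φ.m i) ≤ (y j - x j) * ∫ z, z j ∂(Φ.m i) := by
      rw [← integral_sub (Φ.integrable_expRem hij (hy i) (hy j))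
        (Φ.integrable_expRem hij (hy i) (hx j)), ← integral_const_mul]
      refine integral_mono_ae ((Φ.integrable_expRem hij (hy i) (hy j)).sub
        (Φ.integrable_expRem hij (hy i) (hx j))) ((Φ.integrable_coord hij).const_mul _) ?_
      filter_upwards [Φ.support i] with z hz
      refine (expRem_sub_le ?_).trans (le_of_eq (by ring))
      have := mul_le_mul_of_nonneg_right (hxy j) (hz.1 j)
      linarith
    have h2 := mul_le_mul_of_nonneg_left (Φ.offDiag i j hij) (sub_nonneg.2 (hxy j))
    linarith
  growth := by
    refine ⟨∑ i, ∑ j, |Φ.b i j|, by positivity, fun x hx i => ?_⟩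
    obtain ⟨j, hij⟩ := Fin.exists_ne_two i
    rw [Φ.mech_apply hij]
    have h1 : 0 ≤ ∫ z, expRem (x i * z i + x j * z j) ∂(Φ.m i) :=
      integral_nonneg fun z => expRem_nonneg _
    have h2 : 0 ≤ Φ.c i * x i ^ 2 := mul_nonneg (Φ.c_nonneg i) (sq_nonneg _)
    have h3 : ∀ k, -(|Φ.b i k| * ‖x‖) ≤ Φ.b i k * x k := by
      intro k
      have e : |Φ.b i k * x k| ≤ |Φ.b i k| * ‖x‖ := by
        rw [abs_mul]; exact mul_le_mul_of_nonneg_left (norm_le_pi_norm x k) (abs_nonneg _)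
      exact (abs_le.1 e).1
    have h4 : |Φ.b i i| + |Φ.b i j| ≤ ∑ i, ∑ j, |Φ.b i j| := by
      rw [← Fin.sum_two_of_ne hij fun k => |Φ.b i k|]
      exact Finset.single_le_sum (f := fun i => ∑ j, |Φ.b i j|) (fun i _ => by positivity)
        (Finset.mem_univ i)
    have h5 := mul_le_mul_of_nonneg_right h4 (norm_nonneg x)
    linarith [h3 i, h3 j]

/-- The projection drops `x z_j ≥ 0` from the argument of the increasing function `expRem`. This
turns a bound on `φ*` into a supersolution with equal components. -/
theorem localProj_le_mech_diag (i : Fin 2) {x : ℝ} (hx : 0 ≤ x) :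
    Φ.localProj i x ≤ Φ.mech (fun _ => x) i := by
  obtain ⟨j, hij⟩ := Fin.exists_ne_two i
  rw [Φ.mech_apply hij, localProj, Fin.sum_two_of_ne hij]
  have h0 : Integrable (fun z => expRem (x * z i)) (Φ.m i) := by
    simpa using Φ.integrable_expRem hij hx le_rfl
  have h1 : ∫ z, (Real.exp (-(x * z i)) - 1 + x * z i) ∂(Φ.m i)
      ≤ ∫ z, expRem (x * z i + x * z j) ∂(Φ.m i) := by
    refine integral_mono_ae h0 (Φ.integrable_expRem hij hx hx) ?_
    filter_upwards [Φ.support i] with z hz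
    exact expRem_mono (mul_nonneg hx (hz.1 i)) (le_add_of_nonneg_right (mul_nonneg hx (hz.1 j)))
  linarith

end TwoTypeBranching

namespace SingleTypeBranching

variable (ψ : SingleTypeBranching)

theorem mech_eq (x : ℝ) : ψ.mech x = ψ.b * x + ψ.c * x ^ 2 + ∫ z, expRem (x * z) ∂ψ.m := rfl

theorem integrable_expRem {x : ℝ} (hx : 0 ≤ x) :
    Integrable (fun z => expRem (x * z)) ψ.m := by
  refine (ψ.integrable.const_mul ((2 + 2 * x) * x)).mono'
    (continuous_expRem.comp (by fun_prop)).aestronglyMeasurable ?_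
  filter_upwards [ψ.support] with z hz
  have := abs_expRem_pair_sub_le hz.le le_rfl hx le_rfl le_rfl le_rfl le_rfl hx hx hx (D := x)
    (by simp [abs_of_nonneg hx]) (by simpa using hx)
  simpa [expRem_zero] using this

theorem mech_lip {M : ℝ} (hM : 0 ≤ M) : ∃ L, 0 ≤ L ∧ ∀ x y, 0 ≤ x → 0 ≤ y →
    x ≤ M → y ≤ M → |ψ.mech x - ψ.mech y| ≤ L * |x - y| := by
  set J := ∫ z, (min z (z ^ 2)) ∂ψ.m with hJ
  have hJ0 : 0 ≤ J := by
    refine integral_nonneg_of_ae ?_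
    filter_upwards [ψ.support] with z hz
    exact le_min hz.le (sq_nonneg _)
  refine ⟨|ψ.b| + ψ.c * (2 * M) + (2 + 2 * M) * J, ?_, ?_⟩
  · have := ψ.c_nonneg
    positivity
  intro x y hx hy hxM hyM
  set D := |x - y| with hD
  have hint : |∫ z, expRem (x * z) ∂ψ.m - ∫ z, expRem (y * z) ∂ψ.m| ≤ (2 + 2 * M) * D * J := by
    rw [← integral_sub (ψ.integrable_expRem hx) (ψ.integrable_expRem hy), hJ,
      ← integral_const_mul, ← Real.norm_eq_abs]
    refine norm_integral_le_of_norm_le (ψ.integrable.const_mul _) ?_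
    filter_upwards [ψ.support] with z hz
    simpa using abs_expRem_pair_sub_le hz.le le_rfl hx le_rfl hy le_rfl hxM hM hyM hM (D := D)
      le_rfl (by simp [hD])
  rw [ψ.mech_eq, ψ.mech_eq]
  have e1 : |ψ.b * (x - y)| ≤ |ψ.b| * D := by rw [abs_mul]
  have e3 : |ψ.c * ((x + y) * (x - y))| ≤ ψ.c * (2 * M * D) := by
    rw [abs_mul, abs_of_nonneg ψ.c_nonneg, abs_mul, abs_of_nonneg (add_nonneg hx hy)]
    exact mul_le_mul_of_nonneg_left (mul_le_mul_of_nonneg_right (by linarith) (abs_nonneg _))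
      ψ.c_nonneg
  rw [abs_le] at e1 e3 hint ⊢
  constructor <;> nlinarith

theorem isCumulantField : IsCumulantField (fun (x : Unit → ℝ) _ => ψ.mech (x ())) where
  zero := by
    ext
    simp [ψ.mech_eq, expRem_zero]
  lip M := by
    rcases lt_or_ge M 0 with hM | hM
    · exact ⟨0, le_rfl, fun x y _ _ hx _ => absurd (hx.trans_lt hM) (norm_nonneg x).not_gt⟩
    obtain ⟨L, hL, h⟩ := ψ.mech_lip hM
    refine ⟨L, hL, fun x y hx hy hxM hyM => ?_⟩
    refine (pi_norm_le_iff_of_nonneg (mul_nonneg hL (norm_nonneg _))).2 fun i => ?_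
    exact (h _ _ (hx ()) (hy ()) ((le_abs_self _).trans ((norm_le_pi_norm x ()).trans hxM))
      ((le_abs_self _).trans ((norm_le_pi_norm y ()).trans hyM))).trans
        (mul_le_mul_of_nonneg_left (norm_le_pi_norm (x - y) ()) hL)
  anti i x y _ _ hi := by
    have : x () = y () := hi
    simp [this]
  growth := by
    refine ⟨|ψ.b|, abs_nonneg _, fun x hx i => ?_⟩
    simp only [ψ.mech_eq]
    have h1 : 0 ≤ ∫ z, expRem (x () * z) ∂ψ.m := integral_nonneg fun z => expRem_nonneg _
    have h2 : 0 ≤ ψ.c * x () ^ 2 := mul_nonneg ψ.c_nonneg (sq_nonneg _)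
    have e : |ψ.b * x ()| ≤ |ψ.b| * ‖x‖ := by
      rw [abs_mul]; exact mul_le_mul_of_nonneg_left (norm_le_pi_norm x ()) (abs_nonneg _)
    linarith [(abs_le.1 e).1]

theorem continuousOn_mech : ContinuousOn ψ.mech (Ici 0) := by
  have h : ContinuousOn (fun x : ℝ => (fun (x : Unit → ℝ) (_ : Unit) => ψ.mech (x ()))
      (fun _ => x)) (Ici 0) :=
    ψ.isCumulantField.continuousOn.comp (f := fun (x : ℝ) (_ : Unit) => x)
      (by fun_prop) fun x hx _ => hx
  exact continuousOn_pi.1 h ()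

/-- Used twice: for monotonicity beyond the zeros, and to replace the environment by its upper
bound. -/
theorem mech_mul_le {k x : ℝ} (hk0 : 0 ≤ k) (hk1 : k ≤ 1) (hx : 0 ≤ x) :
    ψ.mech (k * x) ≤ k * ψ.mech x := by
  have h1 : ∫ z, expRem (k * x * z) ∂ψ.m ≤ k * ∫ z, expRem (x * z) ∂ψ.m := by
    rw [← integral_const_mul]
    refine integral_mono (ψ.integrable_expRem (mul_nonneg hk0 hx))
      ((ψ.integrable_expRem hx).const_mul k) fun z => ?_
    simp only [mul_assoc]
    exact expRem_mul_le hk0 hk1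
  have h2 : ψ.c * (k * x) ^ 2 ≤ k * (ψ.c * x ^ 2) := by
    have e : ψ.c * (k * x) ^ 2 = k * (k * (ψ.c * x ^ 2)) := by ring
    rw [e]
    exact mul_le_mul_of_nonneg_left
      (mul_le_of_le_one_left (mul_nonneg ψ.c_nonneg (sq_nonneg _)) hk1) hk0
  rw [ψ.mech_eq, ψ.mech_eq]
  linarith

/-- `ψ` is nondecreasing beyond any point from which on it is positive. -/
theorem mech_mono {θ x y : ℝ} (hθ : 0 < θ) (hpos : ∀ z, θ ≤ z → 0 < ψ.mech z) (hx : θ ≤ x)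
    (hxy : x ≤ y) : ψ.mech x ≤ ψ.mech y := by
  have hy : 0 < y := hθ.trans_le (hx.trans hxy)
  have hk1 : x / y ≤ 1 := (div_le_one hy).2 hxy
  have := ψ.mech_mul_le (k := x / y) (div_nonneg (hθ.le.trans hx) hy.le) hk1 hy.le
  rw [div_mul_cancel₀ _ hy.ne'] at this
  exact this.trans (mul_le_of_le_one_left (hpos y (hx.trans hxy)).le hk1)

end SingleTypeBranching

/-! ### Coming down from infinity -/

/-- A differential inequality with a field whose reciprocal has integral less than `δ` cannot hold
on an interval of length `δ`. -/
theorem lt_of_integral_inv_lt {f y : ℝ → ℝ} {a t Y δ : ℝ} (hat : a + δ ≤ t) (hδ : 0 ≤ δ)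
    (hfc : ContinuousOn f (Ici Y)) (hfpos : ∀ x, Y ≤ x → 0 < f x)
    (hmono : ∀ x x', Y ≤ x → x ≤ x' → f x ≤ f x')
    (hsmall : ∀ z, Y ≤ z → ∫ x in Y..z, (f x)⁻¹ < δ) (hyc : ContinuousOn y (Icc a t))
    (hyY : ∀ r ∈ Icc a t, Y ≤ y r)
    (hy : ∀ r ∈ Icc a t, y a + ∫ s in a..r, f (y s) ≤ y r) : False := by
  have hat' : a ≤ t := by linarith
  set yc : ℝ → ℝ := IccExtend hat' ((Icc a t).domRestrict y) with hyc_def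
  have hycc : Continuous yc := (continuousOn_iff_continuous_domRestrict.1 hyc).Icc_extend'
  have hyc_eq : ∀ r ∈ Icc a t, yc r = y r := fun r hr => IccExtend_of_mem _ _ hr
  have hycY : ∀ r, Y ≤ yc r := fun r => hyY _ (projIcc a t hat' r).2
  have hfyc : Continuous fun r => f (yc r) := hfc.comp_continuous hycc hycY
  -- `y` is merely continuous; `Z` is a differentiable minorant with `Z' = f(y) ≥ f(Z)`.
  set Z : ℝ → ℝ := fun r => y a + ∫ s in a..r, f (yc s) with hZ
  have hZd : ∀ r, HasDerivAt Z (f (yc r)) r := fun r =>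
    (hfyc.integral_hasStrictDerivAt a r).hasDerivAt.const_add _
  have hZle : ∀ r ∈ Icc a t, Z r ≤ y r := by
    intro r hr
    refine le_trans (le_of_eq ?_) (hy r hr)
    simp only [hZ]
    congr 1
    refine intervalIntegral.integral_congr fun s hs => ?_
    rw [uIcc_of_le hr.1] at hs
    simp only [hyc_eq s ⟨hs.1, hs.2.trans hr.2⟩]
  have hZY : ∀ r ∈ Icc a t, Y ≤ Z r := by
    intro r hr
    have h1 : 0 ≤ ∫ s in a..r, f (yc s) :=
      intervalIntegral.integral_nonneg hr.1 fun s _ => (hfpos _ (hycY s)).le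
    have h2 := hyY a ⟨le_rfl, hat'⟩
    simp only [hZ]
    linarith
  set k : ℝ → ℝ := fun x => (f (max x Y))⁻¹ with hk
  have hkc : Continuous k := (hfc.comp_continuous (by fun_prop)
    fun x => mem_Ici.2 (le_max_right _ _)).inv₀
    fun x => (hfpos _ (le_max_right _ _)).ne'
  -- `W ∘ Z` has slope at least `1`, so it gains at least `δ` over `[a, t]`, although `W` stays
  -- below `δ`.
  set W : ℝ → ℝ := fun x => ∫ z in Y..x, k z with hW
  have hWd : ∀ x, HasDerivAt W (k x) x := fun x => (hkc.integral_hasStrictDerivAt Y x).hasDerivAt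
  have hHd : ∀ r, HasDerivAt (fun r => W (Z r)) (k (Z r) * f (yc r)) r := fun r =>
    (hWd (Z r)).comp r (hZd r)
  have hWnn : 0 ≤ W (Z a) := by
    refine intervalIntegral.integral_nonneg (hZY a ⟨le_rfl, hat'⟩) fun s _ => ?_
    exact inv_nonneg.2 (hfpos _ (le_max_right _ _)).le
  have hWlt : W (Z t) < δ := by
    refine lt_of_eq_of_lt ?_ (hsmall (Z t) (hZY t ⟨hat', le_rfl⟩))
    refine intervalIntegral.integral_congr fun s hs => ?_
    rw [uIcc_of_le (hZY t ⟨hat', le_rfl⟩)] at hs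
    simp only [hk, max_eq_left hs.1]
  have hmv := (convex_Icc a t).mul_sub_le_image_sub_of_le_deriv (f := fun r => W (Z r)) (C := 1)
    (fun r _ => (hHd r).continuousAt.continuousWithinAt)
    (fun r _ => (hHd r).differentiableAt.differentiableWithinAt)
    (fun r hr => by
      have hr' := interior_subset hr
      rw [(hHd r).deriv]
      simp only [hk]
      rw [max_eq_left (hZY r hr'), inv_mul_eq_div, one_le_div (hfpos _ (hZY r hr')),
        hyc_eq r hr']
      exact hmono _ _ (hZY r hr') (hZle r hr'))
    a ⟨le_rfl, hat'⟩ t ⟨hat', le_rfl⟩ hat'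
  linarith

theorem SingleTypeBranching.exists_tail_lt (ψ : SingleTypeBranching) (hG : GreyCondition ψ.mech)
    {δ : ℝ} (hδ : 0 < δ) : ∃ θ Y : ℝ, 0 < θ ∧ θ ≤ Y ∧ (∀ z, θ ≤ z → 0 < ψ.mech z) ∧
      ∀ z, Y ≤ z → ∫ x in Y..z, (ψ.mech x)⁻¹ < δ := by
  obtain ⟨θ, hθ, hpos, hint⟩ := hG
  have hlim := intervalIntegral_tendsto_integral_Ioi θ hint tendsto_id
  -- `Y` is taken so far out that the integral of `1/ψ` from `θ` to `Y` misses less than `δ` of the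
  -- total.
  obtain ⟨Y, hY, hθY⟩ := ((hlim.eventually_const_lt (sub_lt_self _ hδ)).and
    (eventually_ge_atTop θ)).exists
  refine ⟨θ, Y, hθ, hθY, hpos, fun z hz => ?_⟩
  have hii : ∀ x x', θ ≤ x → x ≤ x' → IntervalIntegrable (fun x => (ψ.mech x)⁻¹) volume x x' := by
    intro x x' hx hxx'
    rw [intervalIntegrable_iff_integrableOn_Ioc_of_le hxx']
    exact hint.mono_set fun u hu => hx.trans_lt hu.1
  have h1 := intervalIntegral.integral_add_adjacent_intervals (hii θ Y le_rfl hθY)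
    (hii Y z hθY hz)
  have h2 : ∫ x in θ..z, (ψ.mech x)⁻¹ ≤ ∫ x in Ioi θ, (ψ.mech x)⁻¹ := by
    rw [intervalIntegral.integral_of_le (hθY.trans hz)]
    refine setIntegral_mono_set hint ?_ (LE.le.eventuallyLE fun u hu => hu.1)
    exact (ae_restrict_iff' measurableSet_Ioi).2
      (Eventually.of_forall fun u hu => inv_nonneg.2 (hpos u (le_of_lt hu)).le)
  simp only [id] at hY
  linarith

theorem lt_of_forall_first_exit {g : ℝ → ℝ} {a t c : ℝ} (hg : ContinuousOn g (Icc a t))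
    (h : ∀ σ ∈ Icc a t, (∀ x ∈ Ico a σ, c < g x) → c < g σ) {r : ℝ} (hr : r ∈ Icc a t) :
    c < g r := by
  by_contra! hc
  have hcl : IsClosed {x | x ∈ Icc a t ∧ g x ≤ c} :=
    hg.preimage_isClosed_of_isClosed isClosed_Icc isClosed_Iic
  obtain ⟨σ, ⟨hσ, hσc⟩, hmin⟩ := (isCompact_Icc.of_isClosed_subset hcl
    fun x hx => hx.1).exists_isLeast ⟨r, hr, hc⟩
  refine absurd (h σ hσ fun x hx => ?_) (not_lt.2 hσc)
  by_contra! hx'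
  exact absurd (hmin ⟨⟨hx.1, hx.2.le.trans hσ.2⟩, hx'⟩) (not_le.2 hx.2)

/-- Under Grey's condition, solutions come down from infinity: after a time `δ` they are bounded
by a constant that only depends on `δ` and on an upper bound of the environment. -/
theorem SingleTypeBranching.exists_solution_bound (ψ : SingleTypeBranching)
    (hG : GreyCondition ψ.mech) {δ : ℝ} (hδ : 0 < δ) :
    ∃ Y : ℝ, 0 < Y ∧ ∀ (ζ : ℝ → ℝ) (I : Set ℝ) (t l : ℝ) (g : ℝ → ℝ) (a B : ℝ),
      I.OrdConnected → IsCumulantSolution ψ.mech ζ I t l g → a ∈ I → t ∈ I → a + δ ≤ t →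
      (∀ s ∈ Icc a t, ζ s ≤ B) → g a ≤ Real.exp B * Y := by
  obtain ⟨θ, Y, hθ, hθY, hpos, hsmall⟩ := ψ.exists_tail_lt hG hδ
  have hY0 : 0 < Y := hθ.trans_le hθY
  refine ⟨Y, hY0, fun ζ I t l g a B hI hg ha ht hat hB => ?_⟩
  by_contra! hcon
  have hat' : a ≤ t := by linarith
  have hsub := Icc_subset_inter_Iic hI ha ht
  have hgc := hg.continuousOn hI ht ha hat'
  set Q : ℝ → ℝ := fun s => Real.exp (ζ s) • ψ.mech (Real.exp (-ζ s) • g s) with hQ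
  have hexpB : Real.exp B * Real.exp (-B) = 1 := by rw [← Real.exp_add]; simp
  have hflow : ∀ r ∈ Icc a t, IntervalIntegrable Q volume a r ∧ g r = g a + ∫ s in a..r, Q s := by
    intro r hr
    have h1 := hg.restrict (hsub hr).1 hr.2
    refine ⟨h1.integrable a ⟨ha, hr.1⟩, ?_⟩
    have := h1.eq a ⟨ha, hr.1⟩
    linarith
  have hYle : ∀ s, Real.exp B * Y < g s → Y < Real.exp (-B) * g s := by
    intro s hs
    have := mul_lt_mul_of_pos_left hs (Real.exp_pos (-B))
    rwa [← mul_assoc, mul_comm (Real.exp (-B)) (Real.exp B), hexpB, one_mul] at this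
  have hQge : ∀ s ∈ Icc a t, Real.exp B * Y < g s →
      Real.exp B * ψ.mech (Real.exp (-B) * g s) ≤ Q s := by
    intro s hs hgs
    have hg0 : 0 ≤ g s := hg.nonneg s (hsub hs)
    -- Since `ζ s ≤ B`, subhomogeneity gives `e^B ψ(e^{-B} g) ≤ e^ζ ψ(e^{-ζ} g)`: the environment is
    -- replaced by the constant `B`.
    have h1 := ψ.mech_mul_le (k := Real.exp (ζ s - B)) (x := Real.exp (-ζ s) * g s)
      (Real.exp_pos _).le (Real.exp_le_one_iff.2 (by linarith [hB s hs])) (by positivity)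
    rw [← mul_assoc, ← Real.exp_add] at h1
    have e1 : ζ s - B + -ζ s = -B := by ring
    rw [e1] at h1
    have h2 := mul_le_mul_of_nonneg_left h1 (Real.exp_pos B).le
    rw [← mul_assoc (Real.exp B) (Real.exp _), ← Real.exp_add] at h2
    have e2 : B + (ζ s - B) = ζ s := by ring
    rwa [e2] at h2
  have hgt : ∀ r ∈ Icc a t, Real.exp B * Y < g r := by
    intro r hr
    -- As long as `g` exceeds `e^B Y` the integrand is nonnegative, so `g` cannot fall below `g a`
    -- and never leaves this region.
    refine lt_of_forall_first_exit hgc (fun σ hσ hbefore => ?_) hr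
    obtain ⟨_, h2⟩ := hflow σ hσ
    rw [h2]
    refine lt_of_lt_of_le hcon (le_add_of_nonneg_right ?_)
    rw [intervalIntegral.integral_of_le hσ.1, ← integral_Ioc_eq_integral_Ioo.symm]
    refine setIntegral_nonneg measurableSet_Ioo fun s hs => ?_
    have hs' : s ∈ Icc a t := ⟨hs.1.le, hs.2.le.trans hσ.2⟩
    have h3 := hbefore s ⟨hs.1.le, hs.2⟩
    refine le_trans ?_ (hQge s hs' h3)
    exact mul_nonneg (Real.exp_pos _).le (hpos _ (hθY.trans (hYle s h3).le)).le
  refine lt_of_integral_inv_lt (f := ψ.mech) (y := fun s => Real.exp (-B) * g s) (Y := Y) hat hδ.le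
    (ψ.continuousOn_mech.mono (Ici_subset_Ici.2 hY0.le)) (fun x hx => hpos x (hθY.trans hx))
    (fun x x' hx hxx' => ψ.mech_mono hθ hpos (hθY.trans hx) hxx') hsmall
    (continuousOn_const.mul hgc) (fun r hr => (hYle r (hgt r hr)).le) fun r hr => ?_
  obtain ⟨h1, h2⟩ := hflow r hr
  rw [h2, mul_add]
  refine add_le_add_right ?_ _
  rw [← intervalIntegral.integral_const_mul]
  have hsubr : Icc a r ⊆ Icc a t := Icc_subset_Icc_right hr.2
  refine intervalIntegral.integral_mono_on hr.1 ?_ (h1.const_mul _) fun s hs => ?_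
  · refine ContinuousOn.intervalIntegrable ?_
    rw [uIcc_of_le hr.1]
    refine ψ.continuousOn_mech.comp (continuousOn_const.mul (hgc.mono hsubr)) fun s hs => ?_
    exact hY0.le.trans (hYle s (hgt s (hsubr hs))).le
  · have := mul_le_mul_of_nonneg_left (hQge s (hsubr hs) (hgt s (hsubr hs))) (Real.exp_pos (-B)).le
    rwa [← mul_assoc, mul_comm (Real.exp (-B)) (Real.exp B), hexpB, one_mul] at this

/-! ### Low intervals of a Lévy process -/

theorem measure_eventually_le {Ω : Type*} [MeasurableSpace Ω] {P : Measure Ω} {E : ℕ → Set Ω} {ε : ENNReal}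
    (h : ∀ m, P (E m) ≤ ε) :
    P {ω | ∀ᶠ m in atTop, ω ∈ E m} ≤ ε := by
  have h1 : {ω | ∀ᶠ m in atTop, ω ∈ E m} = ⋃ n, ⋂ m ≥ n, E m := by
    ext ω; simp [eventually_atTop]
  rw [h1, Monotone.measure_iUnion]
  · exact iSup_le fun n => (measure_mono (iInter₂_subset n le_rfl)).trans (h n)
  · intro n n' hn
    exact biInter_subset_biInter_left fun m hm => le_trans hn hm

section Probability

variable {Ω : Type*} [MeasurableSpace Ω] {P : Measure Ω} [IsProbabilityMeasure P]

/-- For a random walk, the probability of a large rise within `J` steps after the first passage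
below a level is at most the probability of such a rise at the start. -/
theorem measure_rise_after_hit_le {X : ℕ → Ω → ℝ} (hX : ∀ i, Measurable (X i))
    (hind : iIndepFun X P) (hid : ∀ i j, IdentDistrib (X i) (X j) P P) (c : ℝ) (J : ℕ) :
    P {ω | ∃ k, (∑ i ∈ Finset.range k, X i ω ≤ c ∧ ∀ j < k, c < ∑ i ∈ Finset.range j, X i ω) ∧
        ∃ j ≤ J, 1 < ∑ i ∈ Finset.range j, X (k + i) ω}
      ≤ P {ω | ∃ j ≤ J, 1 < ∑ i ∈ Finset.range j, X i ω} := by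
  -- `A k` (first passage at step `k`) depends on the steps before `k`, and `B k` (a rise
  -- afterwards) on the steps from `k` on. Hence they are independent; the `A k` are disjoint and
  -- all `B k` have the same probability.
  set A : ℕ → Set Ω := fun k =>
    {ω | ∑ i ∈ Finset.range k, X i ω ≤ c ∧ ∀ j < k, c < ∑ i ∈ Finset.range j, X i ω} with hA
  set R : Set (ℕ → ℝ) := {x | ∃ j ≤ J, 1 < ∑ i ∈ Finset.range j, x i} with hR
  set B : ℕ → Set Ω := fun k => (fun ω i => X (k + i) ω) ⁻¹' R with hB
  have hRm : MeasurableSet R := by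
    have : R = ⋃ j, ⋃ _ : j ≤ J, {x : ℕ → ℝ | 1 < ∑ i ∈ Finset.range j, x i} := by
      ext x; simp [hR]
    rw [this]
    refine MeasurableSet.iUnion fun j => MeasurableSet.iUnion fun _ => ?_
    exact measurableSet_lt measurable_const
      (Finset.measurable_sum _ fun i _ => measurable_pi_apply i)
  have hXm : ∀ (T : Set ℕ), ∀ i ∈ T,
      Measurable[⨆ i ∈ T, MeasurableSpace.comap (X i) inferInstance] (X i) := fun T i hi =>
    (comap_measurable (X i)).mono (le_iSup₂_of_le i hi le_rfl) le_rfl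
  have hAm : ∀ k, MeasurableSet[⨆ i ∈ Iio k, MeasurableSpace.comap (X i) inferInstance] (A k) := by
    intro k
    have hS : ∀ j ≤ k, Measurable[⨆ i ∈ Iio k, MeasurableSpace.comap (X i) inferInstance]
        (fun ω => ∑ i ∈ Finset.range j, X i ω) := fun j hj =>
      Finset.measurable_sum _ fun i hi => hXm _ i ((Finset.mem_range.1 hi).trans_le hj)
    have : A k = {ω | ∑ i ∈ Finset.range k, X i ω ≤ c} ∩
        ⋂ j, ⋂ _ : j < k, {ω | c < ∑ i ∈ Finset.range j, X i ω} := by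
      ext ω; simp [hA]
    rw [this]
    refine MeasurableSet.inter (hS k le_rfl measurableSet_Iic)
      (MeasurableSet.iInter fun j => MeasurableSet.iInter fun hj => ?_)
    exact hS j hj.le measurableSet_Ioi
  have hBm : ∀ k, MeasurableSet[⨆ i ∈ Ici k, MeasurableSpace.comap (X i) inferInstance] (B k) := by
    intro k
    have : Measurable[⨆ i ∈ Ici k, MeasurableSpace.comap (X i) inferInstance]
        (fun ω i => X (k + i) ω) :=
      @measurable_pi_lambda Ω ℕ (fun _ => ℝ) (_) _ _ fun i => hXm _ (k + i) (Nat.le_add_right k i)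
    exact this hRm
  have hle : ∀ i, MeasurableSpace.comap (X i) inferInstance ≤ (inferInstance : MeasurableSpace Ω) :=
    fun i => (hX i).comap_le
  have hAB : ∀ k, P (A k ∩ B k) = P (A k) * P (B k) := by
    intro k
    have h1 := indep_iSup_of_disjoint hle hind (S := Iio k) (T := Ici k)
      (Set.disjoint_left.2 fun x hx hx' =>
        absurd (mem_Ici.1 hx') (not_le.2 (mem_Iio.1 hx)))
    exact (Indep_iff _ _ _).1 h1 _ _ (hAm k) (hBm k)
  have hPB : ∀ k, P (B k) = P {ω | ∃ j ≤ J, 1 < ∑ i ∈ Finset.range j, X i ω} := by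
    intro k
    have := IdentDistrib.pi (fun i => hid (k + i) i)
      (hind.precomp (g := fun i => k + i) (add_right_injective k)) hind
    exact this.measure_mem_eq hRm
  have hdisj : Pairwise (Function.onFun Disjoint A) := by
    intro k k' hkk'
    wlog h : k < k' generalizing k k'
    · exact (this hkk'.symm (lt_of_le_of_ne (not_lt.1 h) hkk'.symm)).symm
    exact Set.disjoint_left.2 fun ω hω hω' => absurd hω.1 (not_le.2 (hω'.2 k h))
  have hAmeas : ∀ k, MeasurableSet (A k) := fun k => iSup₂_le (fun i _ => hle i) _ (hAm k)
  calc _ ≤ P (⋃ k, A k ∩ B k) := by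
        refine measure_mono fun ω ⟨k, h1, h2⟩ => mem_iUnion.2 ⟨k, h1, h2⟩
    _ ≤ ∑' k, P (A k ∩ B k) := measure_iUnion_le _
    _ = (∑' k, P (A k)) * P {ω | ∃ j ≤ J, 1 < ∑ i ∈ Finset.range j, X i ω} := by
        simp only [hAB, hPB, ENNReal.tsum_mul_right]
    _ ≤ 1 * P {ω | ∃ j ≤ J, 1 < ∑ i ∈ Finset.range j, X i ω} := by
        gcongr
        rw [← measure_iUnion hdisj hAmeas]
        exact prob_le_one
    _ = _ := one_mul _

theorem exists_dyadic_btwn {x u : ℝ} (hx : 0 ≤ x) (hxu : x < u) :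
    ∃ k m : ℕ, x < k / 2 ^ m ∧ (k : ℝ) / 2 ^ m < u := by
  obtain ⟨m, hm⟩ := exists_pow_lt_of_lt_one (sub_pos.2 hxu) (one_half_lt_one (α := ℝ))
  have h2 : (0 : ℝ) < 2 ^ m := by positivity
  refine ⟨⌊x * 2 ^ m⌋₊ + 1, m, ?_, ?_⟩
  · rw [lt_div_iff₀ h2]
    exact_mod_cast Nat.lt_floor_add_one (x * 2 ^ m)
  · have h3 := Nat.floor_le (mul_nonneg hx h2.le)
    rw [div_lt_iff₀ h2]
    rw [one_div, inv_pow, inv_lt_iff_one_lt_mul₀ h2] at hm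
    push_cast
    linarith

theorem dyadic_refine (k : ℕ) {m n : ℕ} (h : m ≤ n) :
    (k : ℝ) / 2 ^ m = ((k * 2 ^ (n - m) : ℕ) : ℝ) / 2 ^ n := by
  obtain ⟨d, rfl⟩ := Nat.exists_eq_add_of_le h
  have : m + d - m = d := by omega
  rw [this, pow_add]
  push_cast
  field_simp

theorem ContinuousWithinAt.exists_Ico_of_mem_isOpen {ζ : ℝ → ℝ} {t : ℝ}
    (h : ContinuousWithinAt ζ (Ici t) t) {U : Set ℝ} (hU : IsOpen U) (ht : ζ t ∈ U) :
    ∃ u > t, ∀ x ∈ Ico t u, ζ x ∈ U :=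
  mem_nhdsGE_iff_exists_Ico_subset.1 (h.preimage_mem_nhdsWithin (hU.mem_nhds ht))

/-- If a right-continuous path goes below `c` but does not stay below `c + 1` for a time `δ / 2`,
then on all fine dyadic grids it rises by `1` within time `δ` after the first passage. -/
theorem eventually_rise_after_hit {ζ : ℝ → ℝ} (hrc : ∀ t, ContinuousWithinAt ζ (Ici t) t)
    {c δ : ℝ} (hδ : 0 < δ) (hlow : ∃ t, 0 ≤ t ∧ ζ t < c)
    (hno : ¬ ∃ s, 0 ≤ s ∧ ∀ x ∈ Icc s (s + δ / 2), ζ x ≤ c + 1) :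
    ∀ᶠ m : ℕ in atTop, ∃ k : ℕ, (ζ (k / 2 ^ m) ≤ c ∧ ∀ j < k, c < ζ ((j : ℕ) / 2 ^ m)) ∧
      ∃ j ≤ ⌊δ * 2 ^ m⌋₊, 1 < ζ ((k + j : ℕ) / 2 ^ m) - ζ (k / 2 ^ m) := by
  -- Only dyadic times enter, so that every first passage on a grid happens at or after `T = sInf
  -- D`.
  set D : Set ℝ := {t | ζ t ≤ c ∧ ∃ k m : ℕ, t = (k : ℝ) / 2 ^ m} with hD
  have hD0 : ∀ t ∈ D, 0 ≤ t := by
    rintro t ⟨_, k, m, rfl⟩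
    positivity
  have hbdd : BddBelow D := ⟨0, hD0⟩
  have hne : D.Nonempty := by
    obtain ⟨t, ht0, ht⟩ := hlow
    obtain ⟨u, hu, h⟩ := (hrc t).exists_Ico_of_mem_isOpen isOpen_Iio ht
    obtain ⟨k, m, h1, h2⟩ := exists_dyadic_btwn ht0 hu
    exact ⟨_, (h _ ⟨h1.le, h2⟩).le, k, m, rfl⟩
  set T := sInf D with hT
  have hT0 : 0 ≤ T := le_csInf hne hD0
  push Not at hno
  obtain ⟨x, hx, hxc⟩ := hno T hT0
  obtain ⟨u, hu, h⟩ := (hrc x).exists_Ico_of_mem_isOpen isOpen_Ioi hxc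
  -- The high point `x` lies within `δ / 2` of `T`; the remaining half leaves room to move right to
  -- a dyadic time before `T + δ`.
  obtain ⟨kq, mq, hq1, hq2⟩ := exists_dyadic_btwn (hT0.trans hx.1)
    (lt_min hu (show x < T + δ by linarith [hx.2]))
  have hqc : c + 1 < ζ (kq / 2 ^ mq) := h _ ⟨hq1.le, hq2.trans_le (min_le_left _ _)⟩
  have hqδ : (kq : ℝ) / 2 ^ mq < T + δ := hq2.trans_le (min_le_right _ _)
  -- A dyadic time in `D` before the high one. On every grid containing both, the first passage
  -- falls between `T` and this time, hence less than `δ` before the high one.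
  obtain ⟨d, ⟨hdc, kd, md, rfl⟩, hdq⟩ := exists_lt_of_csInf_lt hne (hx.1.trans_lt hq1)
  filter_upwards [eventually_ge_atTop (max mq md)] with m hm
  rw [dyadic_refine kq ((le_max_left _ _).trans hm)] at hqc hdq hqδ
  rw [dyadic_refine kd ((le_max_right _ _).trans hm)] at hdc hdq
  set K := kq * 2 ^ (m - mq)
  classical
  have hex : ∃ k : ℕ, ζ (k / 2 ^ m) ≤ c := ⟨_, hdc⟩
  have h2 : (0 : ℝ) < 2 ^ m := by positivity
  have hkd : Nat.find hex < K := by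
    refine (Nat.find_min' hex hdc).trans_lt ?_
    rw [div_lt_div_iff_of_pos_right h2] at hdq
    exact_mod_cast hdq
  refine ⟨Nat.find hex, ⟨Nat.find_spec hex, fun j hj => not_le.1 (Nat.find_min hex hj)⟩,
    K - Nat.find hex, ?_, ?_⟩
  · refine Nat.le_floor ?_
    have hTk : T ≤ (Nat.find hex : ℝ) / 2 ^ m := csInf_le hbdd ⟨Nat.find_spec hex, _, m, rfl⟩
    rw [le_div_iff₀ h2] at hTk
    rw [div_lt_iff₀ h2] at hqδ
    rw [Nat.cast_sub hkd.le]
    linarith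
  · rw [Nat.add_sub_cancel' hkd.le]
    linarith [Nat.find_spec hex]

variable {ξ : ℝ → Ω → ℝ}

/-- The bound depends neither on the mesh `m` nor on the level `c`. Rational times keep the
right-hand event measurable. -/
theorem IsLevyProcess.measure_grid_rise_le (hξ : IsLevyProcess ξ P) (c δ : ℝ) (m : ℕ) :
    P {ω | ξ 0 ω = 0 ∧ ∃ k : ℕ, (ξ (k / 2 ^ m) ω ≤ c ∧ ∀ j < k, c < ξ ((j : ℕ) / 2 ^ m) ω) ∧
      ∃ j ≤ ⌊δ * 2 ^ m⌋₊, 1 < ξ ((k + j : ℕ) / 2 ^ m) ω - ξ (k / 2 ^ m) ω}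
      ≤ P {ω | ∃ q : ℚ, (0 ≤ (q : ℝ) ∧ (q : ℝ) ≤ δ) ∧ 1 < ξ q ω - ξ 0 ω} := by
  have h2 : (0 : ℝ) < 2 ^ m := by positivity
  set τ : ℕ → ℝ := fun k => (k : ℝ) / 2 ^ m with hτ
  have hτm : Monotone τ := fun i j hij =>
    div_le_div_of_nonneg_right (Nat.cast_le.2 hij) h2.le
  set X : ℕ → Ω → ℝ := fun i ω => ξ (τ (i + 1)) ω - ξ (τ i) ω with hX
  have hid : ∀ i j, IdentDistrib (X i) (X j) P P := by
    intro i j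
    have h1 := hξ.stationary (τ j) (τ (j + 1)) (τ i - τ j) (hτm (Nat.le_succ j))
    have e1 : τ (j + 1) + (τ i - τ j) = τ (i + 1) := by
      simp only [hτ]; push_cast; ring
    have e2 : τ j + (τ i - τ j) = τ i := by ring
    rwa [e1, e2] at h1
  have hsum : ∀ k j ω, ∑ i ∈ Finset.range j, X (k + i) ω = ξ (τ (k + j)) ω - ξ (τ k) ω := by
    intro k j ω
    exact Finset.sum_range_sub (fun i => ξ (τ (k + i)) ω) j
  have hsum0 : ∀ j ω, ∑ i ∈ Finset.range j, X i ω = ξ (τ j) ω - ξ 0 ω := by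
    intro j ω
    have := hsum 0 j ω
    simpa [hτ] using this
  have key := measure_rise_after_hit_le (X := X)
    (fun i => (hξ.measurable _).sub (hξ.measurable _)) (hξ.indep.nat hτm) hid c ⌊δ * 2 ^ m⌋₊
  simp only [hsum, hsum0] at key
  refine le_trans (measure_mono ?_) (key.trans (measure_mono ?_))
  · rintro ω ⟨h0, k, ⟨h1, h3⟩, h4⟩
    refine ⟨k, ⟨?_, fun j hj => ?_⟩, h4⟩
    · rw [h0, sub_zero]; exact h1
    · rw [h0, sub_zero]; exact h3 j hj
  · rintro ω ⟨j, hj, h⟩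
    refine ⟨(j : ℚ) / 2 ^ m, ?_, ?_⟩
    · push_cast
      refine ⟨by positivity, ?_⟩
      rw [div_le_iff₀ h2]
      -- For negative `δ` the natural floor is `0`, which still admits `j = 0`; but then there is no
      -- rise.
      rcases Nat.eq_zero_or_pos j with rfl | hj0
      · by_contra! hneg
        simp [hτ] at h
        linarith
      · exact (Nat.le_floor_iff' hj0.ne').1 hj
    · push_cast
      exact h

/-- The events decrease, and right-continuity at `0` excludes their intersection. -/
theorem IsLevyProcess.tendsto_measure_rise (hξ : IsLevyProcess ξ P) :
    Tendsto (fun n : ℕ => P {ω | ∃ q : ℚ, (0 ≤ (q : ℝ) ∧ (q : ℝ) ≤ 1 / ((n : ℝ) + 1)) ∧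
      1 < ξ q ω - ξ 0 ω}) atTop (𝓝 0) := by
  set V : ℕ → Set Ω := fun n => {ω | ∃ q : ℚ, (0 ≤ (q : ℝ) ∧ (q : ℝ) ≤ 1 / ((n : ℝ) + 1)) ∧
      1 < ξ q ω - ξ 0 ω} with hV
  have hVm : ∀ n, MeasurableSet (V n) := by
    intro n
    have : V n = ⋃ q : ℚ, ⋃ _ : 0 ≤ (q : ℝ) ∧ (q : ℝ) ≤ 1 / ((n : ℝ) + 1),
        {ω | 1 < ξ q ω - ξ 0 ω} := by
      ext ω; simp [hV]
    rw [this]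
    exact MeasurableSet.iUnion fun q => MeasurableSet.iUnion fun _ =>
      measurableSet_lt measurable_const ((hξ.measurable _).sub (hξ.measurable _))
  have hanti : Antitone V := by
    rintro n n' hn ω ⟨q, ⟨h0, h1⟩, h⟩
    exact ⟨q, ⟨h0, h1.trans (one_div_le_one_div_of_le (by positivity) (by gcongr))⟩, h⟩
  have hlim := tendsto_measure_iInter_atTop (μ := P) (fun n => (hVm n).nullMeasurableSet) hanti
    ⟨0, measure_ne_top _ _⟩
  have hnull : P (⋂ n, V n) = 0 := by
    refine measure_mono_null ?_ (ae_iff.1 hξ.cadlag)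
    intro ω hω hc
    obtain ⟨u, hu, h⟩ := (hc 0).1.exists_Ico_of_mem_isOpen
      (U := Iio (ξ 0 ω + 1)) isOpen_Iio (by simp)
    obtain ⟨n, hn⟩ := exists_nat_one_div_lt hu
    obtain ⟨q, ⟨h0, h1⟩, h2⟩ := mem_iInter.1 hω n
    have := h q ⟨h0, h1.trans_lt hn⟩
    simp only [mem_Iio] at this
    linarith
  rwa [hnull] at hlim

/-- Almost surely, if a Lévy process is unbounded below at `+∞`, then it stays below every level
during some time interval whose length does not depend on the level. -/
theorem IsLevyProcess.ae_exists_low_interval (hξ : IsLevyProcess ξ P) :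
    ∀ᵐ ω ∂P, (∀ c : ℝ, ∃ t, 0 ≤ t ∧ ξ t ω < c) →
      ∃ δ > 0, ∀ N : ℕ, ∃ s, 0 ≤ s ∧ ∀ x ∈ Icc s (s + δ), ξ x ω ≤ -N := by
  set δ : ℕ → ℝ := fun n => 1 / ((n : ℝ) + 1) with hδ
  have hδ0 : ∀ n, 0 < δ n := fun n => by positivity
  set bad : ℕ → ℕ → Set Ω := fun n N => {ω | ξ 0 ω = 0 ∧ IsCadlagPath (fun t => ξ t ω) ∧
    (∀ c : ℝ, ∃ t, 0 ≤ t ∧ ξ t ω < c) ∧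
    ¬ ∃ s, 0 ≤ s ∧ ∀ x ∈ Icc s (s + δ n / 2), ξ x ω ≤ -N} with hbad
  have hle : ∀ n N, P (bad n N) ≤
      P {ω | ∃ q : ℚ, (0 ≤ (q : ℝ) ∧ (q : ℝ) ≤ δ n) ∧ 1 < ξ q ω - ξ 0 ω} := by
    intro n N
    refine le_trans (measure_mono ?_) (measure_eventually_le
      fun m => hξ.measure_grid_rise_le (-N - 1) (δ n) m)
    rintro ω ⟨h0, hc, hlow, hno⟩
    have := eventually_rise_after_hit (ζ := fun t => ξ t ω) (c := -N - 1) (fun t => (hc t).1)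
      (hδ0 n) (hlow _) (by simpa using hno)
    exact this.mono fun m hm => ⟨h0, hm⟩
  -- The bound on `bad n N` is uniform in `N`. As the events increase with `N`, their union obeys
  -- the same bound, and letting `n → ∞` makes the intersection over `n` null.
  have hmono : ∀ n, Monotone (bad n) := by
    rintro n N N' hN ω ⟨h0, hc, hlow, hno⟩
    refine ⟨h0, hc, hlow, fun ⟨s, hs, h⟩ => hno ⟨s, hs, fun x hx => (h x hx).trans ?_⟩⟩
    exact neg_le_neg (Nat.cast_le.2 hN)
  have hUnion : ∀ n, P (⋃ N, bad n N) ≤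
      P {ω | ∃ q : ℚ, (0 ≤ (q : ℝ) ∧ (q : ℝ) ≤ δ n) ∧ 1 < ξ q ω - ξ 0 ω} := fun n => by
    rw [(hmono n).measure_iUnion]
    exact iSup_le (hle n)
  have hnull : P (⋂ n, ⋃ N, bad n N) = 0 := by
    refine le_antisymm (ge_of_tendsto' hξ.tendsto_measure_rise fun n => ?_) bot_le
    exact (measure_mono (iInter_subset _ n)).trans (hUnion n)
  filter_upwards [hξ.zero, hξ.cadlag, measure_eq_zero_iff_ae_notMem.1 hnull] with ω h0 hc hω hlow
  by_contra! hcon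
  refine hω (mem_iInter.2 fun n => mem_iUnion.2 ?_)
  obtain ⟨N, hN⟩ := hcon (δ n / 2) (half_pos (hδ0 n))
  refine ⟨N, h0, hc, hlow, ?_⟩
  push Not
  exact hN

end Probability

/-! ### The two-type system and the conclusion -/

section

variable {Φ : TwoTypeBranching} {ψ : SingleTypeBranching} {ζ : ℝ → ℝ} {I : Set ℝ} {t : ℝ}
  {l : Fin 2 → ℝ} {f : ℝ → Fin 2 → ℝ}

theorem TwoTypeBranching.solution_le_scalar
    (hdom : ∀ i z, 0 ≤ z → ψ.mech z ≤ Φ.localProj i z) (hζ : IsLocallyBddPath ζ)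
    (hI : I.OrdConnected) (ht : t ∈ I) (hf : IsCumulantSolution Φ.mech ζ I t l f) {g : ℝ → ℝ}
    (hg : IsCumulantSolution ψ.mech ζ I t ‖l‖ g) {r : ℝ} (hr : r ∈ I ∩ Iic t) (i : Fin 2) :
    f r i ≤ g r := by
  refine hf.le Φ.isCumulantField hζ hI ht (hg.diag (0 : Fin 2))
    (fun i => (le_abs_self _).trans (norm_le_pi_norm l i)) (fun s hs i => ?_) hr i
  have h0 : 0 ≤ Real.exp (-ζ s) * g s := mul_nonneg (Real.exp_pos _).le (hg.nonneg s hs)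
  exact (hdom i _ h0).trans (Φ.localProj_le_mech_diag i h0)

/-- If the local projection is nonnegative, constants are supersolutions. -/
theorem TwoTypeBranching.solution_le_norm (hpos : ∀ i x, 0 ≤ x → 0 ≤ Φ.localProj i x)
    (hζ : IsLocallyBddPath ζ) (hI : I.OrdConnected) (ht : t ∈ I)
    (hf : IsCumulantSolution Φ.mech ζ I t l f) {r : ℝ} (hr : r ∈ I ∩ Iic t) (i : Fin 2) :
    f r i ≤ ‖l‖ := by
  have hconst : IsCumulantSolution (fun _ : Fin 2 → ℝ => 0) ζ I t (fun _ => ‖l‖)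
      (fun _ _ => ‖l‖) := ⟨fun _ _ _ => norm_nonneg _, fun _ _ => by simp, fun _ _ => by simp⟩
  refine hf.le Φ.isCumulantField hζ hI ht hconst
    (fun i => (le_abs_self _).trans (norm_le_pi_norm l i)) (fun s hs i => ?_) hr i
  have h0 : 0 ≤ Real.exp (-ζ s) * ‖l‖ := by positivity
  exact (hpos i _ h0).trans (Φ.localProj_le_mech_diag i h0)

theorem SingleTypeBranching.wellPosed (ψ : SingleTypeBranching) (hζ : IsLocallyBddPath ζ)
    (hζm : Measurable ζ) (hI : I.OrdConnected) : CumulantWellPosed ψ.mech ζ I :=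
  .of_diag ψ.isCumulantField hζ hζm hI

/-- Coming down from infinity for the two-type system. -/
theorem DominatesGrey.exists_solution_bound (hΦ : DominatesGrey Φ ψ) {δ : ℝ} (hδ : 0 < δ) :
    ∃ Y : ℝ, 0 < Y ∧ ∀ (ζ : ℝ → ℝ) (I : Set ℝ) (t : ℝ) (l : Fin 2 → ℝ) (f : ℝ → Fin 2 → ℝ)
      (a B : ℝ), IsLocallyBddPath ζ → Measurable ζ → I.OrdConnected → t ∈ I →
      IsCumulantSolution Φ.mech ζ I t l f → a ∈ I → a + δ ≤ t →
      (∀ s ∈ Icc a (a + δ), ζ s ≤ B) → ∀ i, f a i ≤ Real.exp B * Y := by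
  obtain ⟨Y, hY, h⟩ := ψ.exists_solution_bound hΦ.grey hδ
  refine ⟨Y, hY, fun ζ I t l f a B hζ hζm hI ht hf ha hat hB i => ?_⟩
  -- By the flow property the equation is restarted at `a + δ`, so only the environment on `[a, a +
  -- δ]` matters and the terminal value is irrelevant.
  have hu : a + δ ∈ I := hI.out ha ht ⟨by linarith, hat⟩
  have hg := (ψ.wellPosed hζ hζm hI _ hu ‖f (a + δ)‖ (norm_nonneg _)).1
  exact (TwoTypeBranching.solution_le_scalar hΦ.le hζ hI hu (hf.restrict hu hat) hg
    ⟨ha, by simp [hδ.le]⟩ i).trans (h ζ I _ _ _ a B hI hg ha hu le_rfl hB)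

end

theorem tendsto_atTop_of_monotoneOn_nonneg {ι : Type*} [Fintype ι] {V : (ι → ℝ) → ℝ}
    (hmono : ∀ l l', 0 ≤ l → l ≤ l' → V l ≤ V l') {C : ℝ} (hC : ∀ l, 0 ≤ l → V l ≤ C) :
    ∃ v, Tendsto V atTop (𝓝 v) := by
  have hm : Monotone fun l => V (l ⊔ 0) := fun l l' h =>
    hmono _ _ le_sup_right (sup_le_sup_right h 0)
  have hb : BddAbove (range fun l => V (l ⊔ 0)) := by
    refine ⟨C, ?_⟩
    rintro _ ⟨l, rfl⟩
    exact hC _ le_sup_right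
  refine ⟨_, (tendsto_atTop_ciSup hm hb).congr' ?_⟩
  filter_upwards [eventually_ge_atTop 0] with l hl
  rw [sup_of_le_left hl]

/-- The limit of `v_{0,t}` at infinity, and its decay along an environment with low intervals. -/
theorem DominatesGrey.exists_limit {Φ : TwoTypeBranching} {ψ : SingleTypeBranching}
    (hΦ : DominatesGrey Φ ψ) {ζ : ℝ → ℝ} (hζ : IsLocallyBddPath ζ) (hζm : Measurable ζ)
    {I : Set ℝ} (hI : I.OrdConnected) (h0I : Ici 0 ⊆ I) :
    ∃ vbar : ℝ → Fin 2 → ℝ,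
      (∀ t, 0 < t → Tendsto (fun l : Fin 2 → ℝ => cumulantV Φ.mech ζ I 0 t l) atTop
        (𝓝 (vbar t))) ∧
      ((∀ i, ∀ x, 0 ≤ x → 0 ≤ Φ.localProj i x) →
        (∃ δ > 0, ∀ N : ℕ, ∃ s, 0 ≤ s ∧ ∀ x ∈ Icc s (s + δ), ζ x ≤ -N) →
        Tendsto (fun t => ‖vbar t‖) atTop (𝓝 0)) := by
  have h0 : (0 : ℝ) ∈ I := h0I self_mem_Ici
  have htI : ∀ t, 0 ≤ t → t ∈ I := fun t ht => h0I ht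
  have hwp := Φ.isCumulantField.wellPosed hζ hζm hI
  have hsol : ∀ t, 0 ≤ t → ∀ l : Fin 2 → ℝ, 0 ≤ l →
      IsCumulantSolution Φ.mech ζ I t (Real.exp (ζ t) • l)
        (fun r => cumulantU Φ.mech ζ I r t (Real.exp (ζ t) • l)) := fun t ht l hl =>
    (hwp t (htI t ht) _ (smul_nonneg (Real.exp_pos _).le hl)).1
  have hlim : ∀ t, ∃ v, 0 < t →
      Tendsto (fun l : Fin 2 → ℝ => cumulantV Φ.mech ζ I 0 t l) atTop (𝓝 v) := by
    intro t
    by_cases ht : 0 < t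
    swap
    · exact ⟨0, fun h => absurd h ht⟩
    obtain ⟨Y, hY, hbound⟩ := hΦ.exists_solution_bound ht
    obtain ⟨B, hB⟩ := hζ 0 t
    have hi : ∀ i, ∃ v, Tendsto (fun l : Fin 2 → ℝ => cumulantV Φ.mech ζ I 0 t l i) atTop
        (𝓝 v) := by
      intro i
      refine tendsto_atTop_of_monotoneOn_nonneg (C := Real.exp (-ζ 0) * (Real.exp B * Y))
        (fun l l' hl hll' => ?_) fun l hl => ?_
      · exact mul_le_mul_of_nonneg_left ((hsol t ht.le l hl).mono Φ.isCumulantField hζ hI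
          (htI t ht.le) (hsol t ht.le l' (hl.trans hll'))
          (smul_le_smul_of_nonneg_left hll' (Real.exp_pos _).le) ⟨h0, ht.le⟩ i) (Real.exp_pos _).le
      · refine mul_le_mul_of_nonneg_left ?_ (Real.exp_pos _).le
        refine hbound ζ I t _ _ 0 B hζ hζm hI (htI t ht.le) (hsol t ht.le l hl) h0
          (by rw [zero_add]) (fun s hs => ?_) i
        rw [zero_add] at hs
        exact (le_abs_self _).trans (hB s hs)
    choose v hv using hi
    exact ⟨v, fun _ => tendsto_pi_nhds.2 hv⟩
  choose vbar hvbar using hlim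
  refine ⟨vbar, hvbar, fun hpos hlow => ?_⟩
  obtain ⟨δ, hδ, hlow⟩ := hlow
  obtain ⟨Y, hY, hbound⟩ := hΦ.exists_solution_bound hδ
  rw [Metric.tendsto_atTop]
  intro ε hε
  have hN : Tendsto (fun N : ℕ => Real.exp (-ζ 0) * (Real.exp (-N) * Y)) atTop (𝓝 0) := by
    have h1 : Tendsto (fun N : ℕ => Real.exp (-(N : ℝ))) atTop (𝓝 0) :=
      Real.tendsto_exp_neg_atTop_nhds_zero.comp tendsto_natCast_atTop_atTop
    simpa using (h1.mul_const Y).const_mul (Real.exp (-ζ 0))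
  obtain ⟨N, hN⟩ := (hN.eventually_lt_const hε).exists
  obtain ⟨s, hs, hsN⟩ := hlow N
  -- For all `t ≥ s + δ` the low interval lies inside `[0, t]`: it forces `‖f s‖ ≤ e^{-N} Y`, and
  -- constant supersolutions carry this bound back from `s` to `0`.
  refine ⟨s + δ, fun t ht => ?_⟩
  have ht' : s + δ ≤ t := ht
  have hst : s ≤ t := by linarith
  have ht0 : 0 < t := by linarith
  have hV : ∀ l : Fin 2 → ℝ, 0 ≤ l →
      ‖cumulantV Φ.mech ζ I 0 t l‖ ≤ Real.exp (-ζ 0) * (Real.exp (-N) * Y) := by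
    intro l hl
    have hf := hsol t ht0.le l hl
    set f := fun r => cumulantU Φ.mech ζ I r t (Real.exp (ζ t) • l) with hf_def
    have hfs : ‖f s‖ ≤ Real.exp (-N) * Y := by
      refine (pi_norm_le_iff_of_nonneg (by positivity)).2 fun i => ?_
      rw [Real.norm_of_nonneg (hf.nonneg s ⟨htI s hs, hst⟩ i)]
      exact hbound ζ I t _ f s (-N) hζ hζm hI (htI t ht0.le) hf (htI s hs) ht' hsN i
    have hf0 : ‖f 0‖ ≤ ‖f s‖ := by
      refine (pi_norm_le_iff_of_nonneg (norm_nonneg _)).2 fun i => ?_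
      rw [Real.norm_of_nonneg (hf.nonneg 0 ⟨h0, ht0.le⟩ i)]
      exact TwoTypeBranching.solution_le_norm hpos hζ hI (htI s hs)
        (hf.restrict (htI s hs) hst) ⟨h0, hs⟩ i
    rw [cumulantV, norm_smul, Real.norm_of_nonneg (Real.exp_pos _).le]
    exact mul_le_mul_of_nonneg_left (hf0.trans hfs) (Real.exp_pos _).le
  have hle : ‖vbar t‖ ≤ Real.exp (-ζ 0) * (Real.exp (-N) * Y) :=
    le_of_tendsto (hvbar t ht0).norm ((eventually_ge_atTop 0).mono hV)
  rw [dist_zero_right, norm_norm]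
  exact hle.trans_lt hN

theorem exists_lt_of_liminf_eq_bot {ζ : ℝ → ℝ}
    (h : liminf (fun t => (ζ t : EReal)) atTop = ⊥) (c : ℝ) : ∃ t, 0 ≤ t ∧ ζ t < c := by
  have h1 : ∃ᶠ t in atTop, (ζ t : EReal) < c :=
    frequently_lt_of_liminf_lt (by isBoundedDefault) (by rw [h]; exact EReal.bot_lt_coe c)
  obtain ⟨t, ht, ht0⟩ := (h1.and_eventually (eventually_ge_atTop 0)).exists
  exact ⟨t, ht0, EReal.coe_lt_coe_iff.1 ht⟩

theorem mainTheorem3 {Ω : Type*} [MeasurableSpace Ω] (P : Measure Ω) [IsProbabilityMeasure P]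
    (ξ : ℝ → Ω → ℝ) (hξ : IsLevyProcess ξ P)
    (Φ : TwoTypeBranching) (ψ : SingleTypeBranching) (hΦ : DominatesGrey Φ ψ)
    (I : Set ℝ) (hI : I.OrdConnected) :
    ∀ᵐ ω ∂P,
      -- the random cumulant semigroups `u` of `Φ` and `w` of `ψ` are well defined
      CumulantWellPosed Φ.mech (fun t => ξ t ω) I ∧
      CumulantWellPosed ψ.mech (fun t => ξ t ω) I ∧
      -- comparison (the norm is the maximum norm)
      (∀ t ∈ I, ∀ r ∈ I, r ≤ t → ∀ l : Fin 2 → ℝ, 0 ≤ l → ∀ i : Fin 2,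
        cumulantU Φ.mech (fun t => ξ t ω) I r t l i
          ≤ cumulantU ψ.mech (fun t => ξ t ω) I r t ‖l‖) ∧
      -- the limit of `v_{0,t}` as `l → ∞` exists, and its behaviour as `t → ∞`
      (Ici 0 ⊆ I → ∃ vbar : ℝ → Fin 2 → ℝ,
        (∀ t, 0 < t → Tendsto (fun l : Fin 2 → ℝ =>
          cumulantV Φ.mech (fun t => ξ t ω) I 0 t l) atTop (𝓝 (vbar t))) ∧
        ((∀ i, ∀ x, 0 ≤ x → 0 ≤ Φ.localProj i x) →
          liminf (fun t => (ξ t ω : EReal)) atTop = ⊥ →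
          Tendsto (fun t => ‖vbar t‖) atTop (𝓝 0))) := by
  filter_upwards [hξ.cadlag, hξ.ae_exists_low_interval] with ω hc hlow
  have hζ := hc.isLocallyBdd
  have hζm := hc.measurable
  have hu := Φ.isCumulantField.wellPosed hζ hζm hI
  have hw := ψ.wellPosed hζ hζm hI
  refine ⟨hu, hw, fun t ht r hr hrt l hl i => ?_, fun h0I => ?_⟩
  · exact TwoTypeBranching.solution_le_scalar hΦ.le hζ hI ht (hu t ht l hl).1
      (hw t ht ‖l‖ (norm_nonneg l)).1 ⟨hr, hrt⟩ i
  · obtain ⟨vbar, h1, h2⟩ := hΦ.exists_limit hζ hζm hI h0I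
    exact ⟨vbar, h1, fun hpos hlim => h2 hpos (hlow (exists_lt_of_liminf_eq_bot hlim))⟩
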